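/- Let $k\ge 1$ and $n\ge 2k+4$ be integers. All graphs are finite and simple, and $\lambda_1(G)$ denotes the largest eigenvalue of the adjacency matrix of $G$ (its spectral radius). For $s,t\ge 1$ let $R_k(K_{s,t})$ be the graph obtained from the complete bipartite graph $K_{s,t}$ by replacing one of its edges $uv$ with a path on $2k+1$ vertices; that is, the edge $uv$ is deleted and $u$ and $v$ are joined by a path $u\,u_1u_2\cdots u_{2k-1}\,v$ with $2k-1$ new internal vertices (up to isomorphism the choice of $uv$ does not matter). Put $$R^*=R_k\bigl(K_{\lfloor (n-2k+1)/2\rfloor,\ \lceil (n-2k+1)/2\rceil}\bigr).$$ Then $R^*$ is a non-bipartite graph of order $n$ that contains none of the cycles $C_3,C_5,\ldots,C_{2k+1}$ as a subgraph, and every non-bipartite graph $G$ of order $n$ (connected or not) that contains none of the cycles $C_3,C_5,\ldots,C_{2k+1}$ as a subgraph satisfies $$\lambda_1(G)\le \lambda_1(R^*),$$ with equality if and only if $G\cong R^*$. -/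

import Mathlib

namespace ShortOddCycles

open Classical in
/-- The largest eigenvalue `λ₁(G)` (the spectral radius) of the adjacency matrix of a finite
graph `G` with at least one vertex, see `isGreatest_lambdaOne`. -/
noncomputable def lambdaOne {V : Type*} [Fintype V] (G : SimpleGraph V) : ℝ :=
  sSup (spectrum ℝ (G.adjMatrix ℝ))

open Classical in
/-- `lambdaOne G` is indeed the maximum of the spectrum of the adjacency matrix. -/
theorem isGreatest_lambdaOne {V : Type*} [Fintype V] [Nonempty V] (G : SimpleGraph V) :
    IsGreatest (spectrum ℝ (G.adjMatrix ℝ)) (lambdaOne G) := by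
  have hA : (G.adjMatrix ℝ).IsHermitian := by
    rw [Matrix.IsHermitian, Matrix.conjTranspose_eq_transpose_of_trivial]
    exact G.isSymm_adjMatrix
  have hs := hA.spectrum_real_eq_range_eigenvalues
  have hfin : (spectrum ℝ (G.adjMatrix ℝ)).Finite := hs ▸ Set.finite_range _
  have hne : (spectrum ℝ (G.adjMatrix ℝ)).Nonempty := hs ▸ Set.range_nonempty _
  exact ⟨hne.csSup_mem hfin, fun _ hx => le_csSup hfin.bddAbove hx⟩

/-- `G` contains none of the cycles `C₃, C₅, …, C_{2k+1}` as a (not necessarily induced)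
subgraph. -/
def ShortOddCycleFree {V : Type*} (k : ℕ) (G : SimpleGraph V) : Prop :=
  ∀ i, 1 ≤ i → i ≤ k → (SimpleGraph.cycleGraph (2 * i + 1)).Free G

/-- The graph obtained from `H` by deleting the edge `uv` and joining `u` to `v` by a new path
`u, 0, 1, …, m - 1, v` with `m ≥ 1` new internal vertices. -/
def replaceEdge {V : Type*} (H : SimpleGraph V) (u v : V) (m : ℕ) :
    SimpleGraph (V ⊕ Fin m) where
  Adj
    | .inl a, .inl b => H.Adj a b ∧ s(a, b) ≠ s(u, v)
    | .inl a, .inr i => (a = u ∧ (i : ℕ) = 0) ∨ (a = v ∧ (i : ℕ) + 1 = m)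
    | .inr i, .inl a => (a = u ∧ (i : ℕ) = 0) ∨ (a = v ∧ (i : ℕ) + 1 = m)
    | .inr i, .inr j => (i : ℕ) + 1 = j ∨ (j : ℕ) + 1 = i
  symm := ⟨by
    rintro (a | i) (b | j) h
    · exact ⟨h.1.symm, by rw [Sym2.eq_swap]; exact h.2⟩
    · exact h
    · exact h
    · exact h.symm⟩
  loopless := ⟨by
    rintro (a | i) h
    · exact H.loopless.irrefl a h.1
    · rcases h with h | h <;> omega⟩

/-- `R_k(K_{s,t})`: the complete bipartite graph `K_{s,t}` with one edge replaced by a path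
`P_{2k+1}` on `2k+1` vertices, of which the two end vertices are the ends of the edge and
the `2k-1` internal vertices are new. -/
def R (k s t : ℕ) (hs : 0 < s) (ht : 0 < t) :
    SimpleGraph ((Fin s ⊕ Fin t) ⊕ Fin (2 * k - 1)) :=
  replaceEdge (completeBipartiteGraph (Fin s) (Fin t)) (.inl ⟨0, hs⟩) (.inr ⟨0, ht⟩) (2 * k - 1)

/-- The graph `R_k(K_{⌊(n-2k+1)/2⌋,⌈(n-2k+1)/2⌉})`, for `n ≥ 2k + 4`. -/
def extremalGraph (k n : ℕ) (hn : 2 * k + 4 ≤ n) :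
    SimpleGraph ((Fin ((n - 2 * k + 1) / 2) ⊕ Fin ((n - 2 * k + 2) / 2)) ⊕ Fin (2 * k - 1)) :=
  R k ((n - 2 * k + 1) / 2) ((n - 2 * k + 2) / 2) (by omega) (by omega)

end ShortOddCycles

/-!
The extremal graph is a blow-up of the cycle `C_{2k+3}` in which two consecutive vertices `0` and
`1` are replaced by independent sets; the path that replaces an edge has the ends `2` and
`2k+2` (`R_eq_cycleBlowup`). The proof turns an arbitrary non-bipartite graph `G` without short odd
cycles into such a blow-up on the same vertex set, without decreasing the value `xᵀ A x` of a
fixed nonnegative eigenvector `x` of `G` for `λ₁(G)`.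

*Symmetrization* (`IsShortestOddCycle.exists_blowup`). Let `c` be a shortest odd cycle of `G`, of
length `g ≥ 2k + 3`. Among the vertices outside `c` let `w₀` have the largest neighbour weight.
Making all its non-neighbours outside `c` twins of `w₀`, and then all its neighbours outside `c`
twins of that neighbour which sees the largest weight on `c`, does not decrease `xᵀ A x`. Since no
odd closed walk is shorter than `g`, two adjacent vertices outside `c` attach to `c` at most like
two consecutive vertices of `c` do (`exists_consecutive_centres`). So the result is contained in a
blow-up of `C_g` at two consecutive vertices.

*Folding* (`cycleBlowup_le_fold`). Wrapping part of the cycle around the edge `01` shows that a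
blow-up of `C_g` is contained in a blow-up of `C_{2k+3}`.

*Balancing* (`IsBlowupLabelling.lambdaOne_lt`). In terms of class weights the eigenvalue equation
along the path from class `1` to class `0` is invariant under reflection, and a suitable
combination of the Perron vector with its reflection shows that `λ₁` strictly increases when the
two classes become more equal.

*Equality.* If `λ₁(G)` equals the maximum, then `x` is also a Perron vector of the blow-up, hence
positive, and every vertex has the same neighbour weight in `G` and in the blow-up. A
neighbourhood contained in another one of the same weight is equal to it, and together with
triangle-freeness this forces `G` to be the blow-up.
-/

namespace ShortOddCycles

/-! ### Largest eigenvalue and the adjacency form -/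

section Spectral

variable {V : Type*} [Fintype V]

open Classical in
/-- The sum of `x` over the neighbours of `v`, i.e. the `v`-th entry of `A x` for the adjacency
matrix `A` of `G`. -/
noncomputable def nbrSum (G : SimpleGraph V) (x : V → ℝ) (v : V) : ℝ :=
  ∑ w, if G.Adj v w then x w else 0

/-- The bilinear form `xᵀ A y` of the adjacency matrix `A` of `G`. -/
noncomputable def adjBilin (G : SimpleGraph V) (x y : V → ℝ) : ℝ :=
  ∑ v, x v * nbrSum G y v

/-- The quadratic form `xᵀ A x` of the adjacency matrix `A` of `G`. -/
noncomputable def adjForm (G : SimpleGraph V) (x : V → ℝ) : ℝ :=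
  ∑ v, x v * nbrSum G x v

theorem adjBilin_add_left (G : SimpleGraph V) (x y z : V → ℝ) :
    adjBilin G (x + y) z = adjBilin G x z + adjBilin G y z := by
  simp only [adjBilin, Pi.add_apply, add_mul, Finset.sum_add_distrib]

theorem adjBilin_comm (G : SimpleGraph V) (x y : V → ℝ) : adjBilin G x y = adjBilin G y x := by
  classical
  simp only [adjBilin, nbrSum, Finset.mul_sum]
  rw [Finset.sum_comm]
  refine Finset.sum_congr rfl fun v _ => Finset.sum_congr rfl fun w _ => ?_
  simp only [G.adj_comm v w]
  split_ifs <;> ring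

theorem adjBilin_add_right (G : SimpleGraph V) (x y z : V → ℝ) :
    adjBilin G x (y + z) = adjBilin G x y + adjBilin G x z := by
  rw [adjBilin_comm, adjBilin_add_left, adjBilin_comm G y, adjBilin_comm G z]

theorem adjBilin_le {G H : SimpleGraph V} {x y : V → ℝ} (hx : ∀ v, 0 ≤ x v)
    (h : ∀ v, 0 < x v → nbrSum G y v ≤ nbrSum H y v) : adjBilin G x y ≤ adjBilin H x y := by
  refine Finset.sum_le_sum fun v _ => ?_
  rcases (hx v).eq_or_lt with hv | hv
  · simp [← hv]
  · exact mul_le_mul_of_nonneg_left (h v hv) hv.le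

theorem adjBilin_nonneg {G : SimpleGraph V} {x y : V → ℝ} (hx : ∀ v, 0 ≤ x v)
    (hy : ∀ v, 0 ≤ y v) : 0 ≤ adjBilin G x y :=
  Finset.sum_nonneg fun v _ => mul_nonneg (hx v) <|
    Finset.sum_nonneg fun w _ => by split_ifs <;> simp [hy]

theorem adjBilin_eq_zero {G : SimpleGraph V} {x y : V → ℝ}
    (h : ∀ v w, x v ≠ 0 → y w ≠ 0 → ¬ G.Adj v w) : adjBilin G x y = 0 := by
  refine Finset.sum_eq_zero fun v _ => ?_
  by_cases hv : x v = 0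
  · simp [hv]
  · rw [nbrSum, Finset.sum_eq_zero, mul_zero]
    intro w _
    by_cases hw : y w = 0
    · simp [hw]
    · rw [if_neg (h v w hv hw)]

open Classical in
theorem adjMatrix_mulVec_eq_nbrSum (G : SimpleGraph V) (x : V → ℝ) :
    (G.adjMatrix ℝ).mulVec x = nbrSum G x := by
  ext v
  simp [nbrSum, Matrix.mulVec, dotProduct, SimpleGraph.adjMatrix_apply]

open Classical in
theorem posSemidef_lambdaOne_sub_adjMatrix (G : SimpleGraph V) :
    (algebraMap ℝ (Matrix V V ℝ) (lambdaOne G) - G.adjMatrix ℝ).PosSemidef := by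
  have hA : (G.adjMatrix ℝ).IsHermitian := by
    rw [Matrix.IsHermitian, Matrix.conjTranspose_eq_transpose_of_trivial]
    exact G.isSymm_adjMatrix
  rw [Matrix.posSemidef_iff_isHermitian_and_spectrum_nonneg]
  constructor
  · refine Matrix.IsHermitian.sub ?_ hA
    rw [Matrix.algebraMap_eq_diagonal]
    exact Matrix.isHermitian_diagonal _
  · intro t ht
    rw [← spectrum.singleton_sub_eq] at ht
    obtain ⟨a, ha, b, hb, rfl⟩ := ht
    have : Nonempty V := by
      by_contra hne
      rw [not_nonempty_iff] at hne
      simp [spectrum.of_subsingleton] at hb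
    rw [Set.mem_singleton_iff] at ha
    have := (isGreatest_lambdaOne G).2 hb
    simp only [Set.mem_ofPred_eq]
    linarith

open Classical in
theorem dotProduct_lambdaOne_sub_mulVec (G : SimpleGraph V) (x : V → ℝ) :
    star x ⬝ᵥ (algebraMap ℝ (Matrix V V ℝ) (lambdaOne G) - G.adjMatrix ℝ).mulVec x =
      lambdaOne G * ∑ v, x v ^ 2 - adjForm G x := by
  rw [Matrix.sub_mulVec, dotProduct_sub, adjMatrix_mulVec_eq_nbrSum, Matrix.algebraMap_eq_diagonal]
  simp only [dotProduct, adjForm, Matrix.mulVec_diagonal, Finset.mul_sum]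
  congr 1
  refine Finset.sum_congr rfl fun v _ => ?_
  simp
  ring

theorem adjForm_le (G : SimpleGraph V) (x : V → ℝ) :
    adjForm G x ≤ lambdaOne G * ∑ v, x v ^ 2 := by
  classical
  have h := (posSemidef_lambdaOne_sub_adjMatrix G).dotProduct_mulVec_nonneg x
  rw [dotProduct_lambdaOne_sub_mulVec] at h
  linarith

/-- Equality in the Rayleigh bound `adjForm_le` forces an eigenvector, since `λ₁ - A` is positive
semidefinite. -/
theorem nbrSum_eq_of_adjForm_eq (G : SimpleGraph V) (x : V → ℝ)
    (hx : adjForm G x = lambdaOne G * ∑ v, x v ^ 2) (v : V) :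
    nbrSum G x v = lambdaOne G * x v := by
  classical
  have h := ((posSemidef_lambdaOne_sub_adjMatrix G).dotProduct_mulVec_zero_iff x).1
    (by rw [dotProduct_lambdaOne_sub_mulVec]; linarith)
  have h := congrFun h v
  rw [Matrix.sub_mulVec, adjMatrix_mulVec_eq_nbrSum, Matrix.algebraMap_eq_diagonal] at h
  simp [Matrix.mulVec_diagonal] at h
  linarith

theorem adjForm_eq_of_nbrSum_eq {G : SimpleGraph V} {x : V → ℝ} {μ : ℝ}
    (h : ∀ v, nbrSum G x v = μ * x v) : adjForm G x = μ * ∑ v, x v ^ 2 := by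
  rw [adjForm, Finset.mul_sum]
  exact Finset.sum_congr rfl fun v _ => by rw [h]; ring

/-- Perron–Frobenius: replacing an eigenvector by its absolute value does not decrease the
adjacency form, so the absolute value is again an eigenvector. -/
theorem exists_nonneg_eigenvector [Nonempty V] (G : SimpleGraph V) :
    ∃ x : V → ℝ, (∀ v, 0 ≤ x v) ∧ 0 < ∑ v, x v ^ 2 ∧
      ∀ v, nbrSum G x v = lambdaOne G * x v := by
  classical
  have hmem := (isGreatest_lambdaOne G).1
  rw [← Matrix.spectrum_toLin', ← Module.End.hasEigenvalue_iff_mem_spectrum] at hmem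
  obtain ⟨y, hy⟩ := hmem.exists_hasEigenvector
  have hy1 : ∀ v, nbrSum G y v = lambdaOne G * y v := by
    intro v
    have := congrFun hy.apply_eq_smul v
    rwa [Matrix.toLin'_apply, adjMatrix_mulVec_eq_nbrSum] at this
  have hpos : 0 < ∑ v, |y v| ^ 2 := by
    obtain ⟨v, hv⟩ := Function.ne_iff.1 hy.2
    refine Finset.sum_pos' (fun _ _ => by positivity) ⟨v, Finset.mem_univ _, ?_⟩
    have : 0 < |y v| := abs_pos.2 hv
    positivity
  refine ⟨fun v => |y v|, fun v => abs_nonneg _, hpos, ?_⟩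
  refine nbrSum_eq_of_adjForm_eq G _ (le_antisymm (adjForm_le G _) ?_)
  have h1 := adjForm_eq_of_nbrSum_eq hy1
  simp only [sq_abs]
  rw [← h1]
  simp only [adjForm, nbrSum, Finset.mul_sum]
  refine Finset.sum_le_sum fun v _ => Finset.sum_le_sum fun w _ => ?_
  split_ifs
  · rw [← abs_mul]; exact le_abs_self _
  · simp

theorem le_lambdaOne_of_mul_le_nbrSum {G : SimpleGraph V} {x : V → ℝ} {μ : ℝ}
    (hx : ∀ v, 0 ≤ x v) (hpos : 0 < ∑ v, x v ^ 2) (h : ∀ v, μ * x v ≤ nbrSum G x v) :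
    μ ≤ lambdaOne G := by
  have h1 : μ * ∑ v, x v ^ 2 ≤ adjForm G x := by
    rw [adjForm, Finset.mul_sum]
    exact Finset.sum_le_sum fun v _ => by nlinarith [hx v, h v]
  exact le_of_mul_le_mul_right (h1.trans (adjForm_le G x)) hpos

theorem lt_lambdaOne_of_mul_le_nbrSum {G : SimpleGraph V} {x : V → ℝ} {μ : ℝ}
    (hx : ∀ v, 0 ≤ x v) (hpos : 0 < ∑ v, x v ^ 2) (h : ∀ v, μ * x v ≤ nbrSum G x v)
    {v₀ : V} (h₀ : μ * x v₀ < nbrSum G x v₀) :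
    μ < lambdaOne G := by
  refine lt_of_le_of_ne (le_lambdaOne_of_mul_le_nbrSum hx hpos h) fun hμ => ?_
  have h1 : μ * ∑ v, x v ^ 2 ≤ adjForm G x := by
    rw [adjForm, Finset.mul_sum]
    exact Finset.sum_le_sum fun v _ => by nlinarith [hx v, h v]
  rw [hμ] at h1
  have := nbrSum_eq_of_adjForm_eq G x (le_antisymm (adjForm_le G x) h1) v₀
  rw [← hμ] at this
  linarith

theorem nbrSum_mono {G H : SimpleGraph V} {x : V → ℝ} (hx : ∀ v, 0 ≤ x v) {u v : V}
    (h : ∀ w, 0 < x w → G.Adj u w → H.Adj v w) : nbrSum G x u ≤ nbrSum H x v := by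
  classical
  refine Finset.sum_le_sum fun w _ => ?_
  rcases (hx w).eq_or_lt with hw | hw
  · simp [← hw]
  · have := h w hw
    split_ifs <;> simp_all [le_of_lt]

/-- A neighbourhood contained in another one of the same positive weight is equal to it. -/
theorem adj_iff_of_nbrSum_eq {G H : SimpleGraph V} {x : V → ℝ} (hx : ∀ v, 0 < x v) {u v : V}
    (h : ∀ w, G.Adj u w → H.Adj v w) (heq : nbrSum G x u = nbrSum H x v) (w : V) :
    G.Adj u w ↔ H.Adj v w := by
  classical
  refine ⟨h w, fun hw => ?_⟩
  have hle : ∀ z ∈ Finset.univ, (if G.Adj u z then x z else 0) ≤ if H.Adj v z then x z else 0 := by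
    intro z _
    have := h z
    have := hx z
    split_ifs <;> simp_all [le_of_lt]
  have := (Finset.sum_eq_sum_iff_of_le hle).1 heq w (Finset.mem_univ _)
  by_contra hn
  have := hx w
  simp_all

theorem adjForm_mono {G H : SimpleGraph V} {x : V → ℝ} (hx : ∀ v, 0 ≤ x v) (h : G ≤ H) :
    adjForm G x ≤ adjForm H x :=
  Finset.sum_le_sum fun v _ => mul_le_mul_of_nonneg_left (nbrSum_mono hx fun _ _ hw => h hw) (hx v)

theorem eq_of_le_of_nbrSum_eq {G H : SimpleGraph V} {x : V → ℝ} (hx : ∀ v, 0 < x v) (h : G ≤ H)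
    (heq : ∀ v, nbrSum G x v = nbrSum H x v) : G = H := by
  ext u v
  exact adj_iff_of_nbrSum_eq hx (fun _ hw => h hw) (heq u) v

theorem eq_of_le_of_adjForm_eq {G H : SimpleGraph V} {x : V → ℝ} (hx : ∀ v, 0 < x v) (h : G ≤ H)
    (heq : adjForm G x = adjForm H x) : G = H := by
  refine eq_of_le_of_nbrSum_eq hx h fun v => ?_
  have hle : ∀ z ∈ Finset.univ, x z * nbrSum G x z ≤ x z * nbrSum H x z := fun z _ =>
    mul_le_mul_of_nonneg_left (nbrSum_mono (fun z => (hx z).le) fun _ _ hw => h hw) (hx z).le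
  exact mul_left_cancel₀ (hx v).ne' ((Finset.sum_eq_sum_iff_of_le hle).1 heq v (Finset.mem_univ _))

theorem nbrSum_comp_iso {V' : Type*} [Fintype V'] {G : SimpleGraph V} {H : SimpleGraph V'}
    (e : G ≃g H) (x : V' → ℝ) (v : V) : nbrSum G (x ∘ e) v = nbrSum H x (e v) := by
  classical
  rw [nbrSum, nbrSum, ← e.toEquiv.sum_comp]
  refine Finset.sum_congr rfl fun w _ => ?_
  have : H.Adj (e v) (e w) ↔ G.Adj v w := e.map_adj_iff
  simp [this]

theorem lambdaOne_le_of_iso {V' : Type*} [Fintype V'] [Nonempty V'] {G : SimpleGraph V}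
    {H : SimpleGraph V'} (e : G ≃g H) : lambdaOne H ≤ lambdaOne G := by
  obtain ⟨x, hx, hpos, h⟩ := exists_nonneg_eigenvector H
  refine le_lambdaOne_of_mul_le_nbrSum (x := x ∘ e) (fun v => hx _) ?_ fun v => ?_
  · exact hpos.trans_eq (e.toEquiv.sum_comp fun v => x v ^ 2).symm
  · rw [nbrSum_comp_iso, h]; rfl

theorem lambdaOne_eq_of_iso {V' : Type*} [Fintype V'] [Nonempty V] {G : SimpleGraph V}
    {H : SimpleGraph V'} (e : G ≃g H) : lambdaOne G = lambdaOne H := by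
  have : Nonempty V' := e.toEquiv.nonempty_congr.1 inferInstance
  exact le_antisymm (lambdaOne_le_of_iso e.symm) (lambdaOne_le_of_iso e)

end Spectral

/-! ### Blow-ups of a cycle at two consecutive vertices -/

/-- `i` and `j` are consecutive in the cyclic order `0, 1, …, g - 1`. -/
def CycAdj (g i j : ℕ) : Prop :=
  i + 1 = j ∨ j + 1 = i ∨ (i = 0 ∧ 0 < j ∧ j + 1 = g) ∨ (j = 0 ∧ 0 < i ∧ i + 1 = g)

/-- The graph on `V` in which two vertices are adjacent when their labels are consecutive in the
cyclic order `0, 1, …, g - 1`. -/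
def cycleBlowup {V : Type*} (g : ℕ) (φ : V → ℕ) : SimpleGraph V where
  Adj u v := CycAdj g (φ u) (φ v)
  symm := ⟨fun u v h => by unfold CycAdj at *; omega⟩
  loopless := ⟨fun u h => by unfold CycAdj at *; omega⟩

/-- Labels `0, …, g - 1` on `V`, each used, of which only `0` and `1` may be used more than once.
The graph `cycleBlowup g φ` is then the cycle `C_g` with the vertices `0` and `1` replaced by
independent sets. -/
structure IsBlowupLabelling {V : Type*} (g : ℕ) (φ : V → ℕ) : Prop where
  lt : ∀ v, φ v < g
  exists_zero : ∃ v, φ v = 0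
  exists_one : ∃ v, φ v = 1
  existsUnique : ∀ j, 2 ≤ j → j < g → ∃! v, φ v = j

/-- The number of vertices with label `j`. -/
def labelCard {V : Type*} [Fintype V] (φ : V → ℕ) (j : ℕ) : ℕ :=
  (Finset.univ.filter fun v => φ v = j).card

/-- The total weight of the vertices with label `j`. -/
noncomputable def labelSum {V : Type*} [Fintype V] (φ : V → ℕ) (x : V → ℝ) (j : ℕ) : ℝ :=
  ∑ v, if φ v = j then x v else 0

/-- The cyclic predecessor in `0, 1, …, g - 1`. -/
def cycPred (g j : ℕ) : ℕ := if j = 0 then g - 1 else j - 1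

/-- The cyclic successor in `0, 1, …, g - 1`. -/
def cycSucc (g j : ℕ) : ℕ := if j + 1 = g then 0 else j + 1

section Labelling

variable {V : Type*} {g : ℕ} {φ : V → ℕ}

theorem IsBlowupLabelling.exists_label (hφ : IsBlowupLabelling g φ) {j : ℕ} (hj : j < g) :
    ∃ v, φ v = j := by
  rcases Nat.lt_or_ge j 2 with h | h
  · interval_cases j
    · exact hφ.exists_zero
    · exact hφ.exists_one
  · exact (hφ.existsUnique j h hj).exists

/-- The reflection of the cycle `0, 1, …, g - 1` that exchanges `0` and `1`. -/
def cycReflect (g j : ℕ) : ℕ := if j ≤ 1 then 1 - j else g + 1 - j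

theorem IsBlowupLabelling.reflect (hg : 3 ≤ g) (hφ : IsBlowupLabelling g φ) :
    IsBlowupLabelling g (fun v => cycReflect g (φ v)) := by
  refine ⟨fun v => ?_, ?_, ?_, fun j hj hjg => ?_⟩
  · have := hφ.lt v
    unfold cycReflect
    split_ifs <;> omega
  · obtain ⟨v, hv⟩ := hφ.exists_one
    exact ⟨v, by simp [hv, cycReflect]⟩
  · obtain ⟨v, hv⟩ := hφ.exists_zero
    exact ⟨v, by simp [hv, cycReflect]⟩
  · obtain ⟨v, hv, h⟩ := hφ.existsUnique (g + 1 - j) (by omega) (by omega)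
    refine ⟨v, ?_, fun w hw => h w ?_⟩
    · simp only [cycReflect] at *
      split_ifs <;> omega
    · have := hφ.lt w
      simp only [cycReflect] at *
      split_ifs at hw <;> omega

theorem cycleBlowup_reflect (hg : 3 ≤ g) (hφ : ∀ v, φ v < g) :
    cycleBlowup g (fun v => cycReflect g (φ v)) = cycleBlowup g φ := by
  ext u v
  have := hφ u
  have := hφ v
  simp only [cycleBlowup, CycAdj, cycReflect]
  split_ifs <;> omega

/-- Wrapping the first `d` vertices of the cycle `0, 1, …, h + d - 1` back and forth along the
edge `01` gives a homomorphism onto the cycle `0, 1, …, h - 1`, for even `d`. -/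
def cycFold (d j : ℕ) : ℕ := if j < d then j % 2 else j - d

theorem IsBlowupLabelling.fold {h e : ℕ} (hh : 3 ≤ h) (hφ : IsBlowupLabelling (h + 2 * e) φ) :
    IsBlowupLabelling h (fun v => cycFold (2 * e) (φ v)) := by
  refine ⟨fun v => ?_, ?_, ?_, fun j hj hjg => ?_⟩
  · have := hφ.lt v
    unfold cycFold
    split_ifs <;> omega
  · obtain ⟨v, hv⟩ := hφ.exists_zero
    exact ⟨v, by simp [hv, cycFold]⟩
  · obtain ⟨v, hv⟩ := hφ.exists_one
    refine ⟨v, ?_⟩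
    simp only [hv, cycFold]
    split_ifs <;> omega
  · obtain ⟨v, hv, hu⟩ := hφ.existsUnique (j + 2 * e) (by omega) (by omega)
    refine ⟨v, ?_, fun w hw => hu w ?_⟩
    · simp only [cycFold] at *
      split_ifs <;> omega
    · simp only [cycFold] at *
      split_ifs at hw <;> omega

/-- Folding a longer cycle of the same parity onto a shorter one only adds edges to a blow-up. -/
theorem cycleBlowup_le_fold {h e : ℕ} (hh : 3 ≤ h) (φ : V → ℕ) :
    cycleBlowup (h + 2 * e) φ ≤ cycleBlowup h (fun v => cycFold (2 * e) (φ v)) := by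
  intro u v huv
  simp only [cycleBlowup, CycAdj, cycFold] at *
  split_ifs <;> omega

end Labelling

section Blowup

variable {V : Type*} [Fintype V] {V' : Type*} [Fintype V'] {g : ℕ} {φ : V → ℕ} {ψ : V' → ℕ}

theorem nbrSum_cycleBlowup (hg : 3 ≤ g) (hφ : ∀ v, φ v < g) (x : V → ℝ) (v : V) :
    nbrSum (cycleBlowup g φ) x v =
      labelSum φ x (cycPred g (φ v)) + labelSum φ x (cycSucc g (φ v)) := by
  classical
  rw [nbrSum, labelSum, labelSum, ← Finset.sum_add_distrib]
  refine Finset.sum_congr rfl fun w _ => ?_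
  have h1 := hφ v
  have h2 := hφ w
  have h3 : (cycleBlowup g φ).Adj v w ↔ φ w = cycPred g (φ v) ∨ φ w = cycSucc g (φ v) := by
    simp only [cycleBlowup, CycAdj, cycPred, cycSucc]
    split_ifs <;> omega
  have h4 : cycPred g (φ v) ≠ cycSucc g (φ v) := by
    simp only [cycPred, cycSucc]
    split_ifs <;> omega
  simp only [h3]
  by_cases h5 : φ w = cycPred g (φ v)
  · simp [h5, h4]
  · simp [h5]

theorem labelSum_nonneg {x : V → ℝ} (hx : ∀ v, 0 ≤ x v) (j : ℕ) : 0 ≤ labelSum φ x j :=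
  Finset.sum_nonneg fun v _ => by split_ifs <;> simp [hx]

theorem labelSum_eq_zero_iff {x : V → ℝ} (hx : ∀ v, 0 ≤ x v) (j : ℕ) :
    labelSum φ x j = 0 ↔ ∀ v, φ v = j → x v = 0 := by
  rw [labelSum, Finset.sum_eq_zero_iff_of_nonneg fun v _ => by split_ifs <;> simp [hx]]
  simp

theorem labelSum_eq_mul {x : V → ℝ} {j : ℕ} {c : ℝ} (h : ∀ v, φ v = j → x v = c) :
    labelSum φ x j = labelCard φ j * c := by
  rw [labelSum, labelCard, ← nsmul_eq_mul, ← Finset.sum_const, Finset.sum_filter]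
  exact Finset.sum_congr rfl fun v _ => by split_ifs with h1 <;> simp [*]

theorem labelCard_pos_iff {j : ℕ} : 0 < labelCard φ j ↔ ∃ v, φ v = j := by
  rw [labelCard, Finset.card_pos]
  simp [Finset.Nonempty]

theorem IsBlowupLabelling.labelCard_eq_one (hφ : IsBlowupLabelling g φ) {j : ℕ} (hj : 2 ≤ j)
    (hjg : j < g) : labelCard φ j = 1 := by
  obtain ⟨v, hv, h⟩ := hφ.existsUnique j hj hjg
  rw [labelCard, Finset.card_eq_one]
  refine ⟨v, ?_⟩
  ext w
  simp only [Finset.mem_filter, Finset.mem_univ, true_and, Finset.mem_singleton]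
  exact ⟨h w, fun hw => hw ▸ hv⟩

theorem IsBlowupLabelling.labelCard_eq_zero (hφ : IsBlowupLabelling g φ) {j : ℕ} (hj : g ≤ j) :
    labelCard φ j = 0 := by
  rw [← Nat.le_zero, ← not_lt, labelCard_pos_iff]
  rintro ⟨v, hv⟩
  have := hφ.lt v
  omega

theorem IsBlowupLabelling.card_eq (hg : 2 ≤ g) (hφ : IsBlowupLabelling g φ) :
    Fintype.card V = labelCard φ 0 + labelCard φ 1 + (g - 2) := by
  have h := Finset.card_eq_sum_card_fiberwise (s := Finset.univ) (t := Finset.range g) (f := φ)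
    (fun v _ => by simpa using hφ.lt v)
  obtain ⟨m, rfl⟩ := Nat.exists_eq_add_of_le' hg
  rw [Finset.card_univ, Finset.sum_range_succ', Finset.sum_range_succ'] at h
  have h1 : ∀ i ∈ Finset.range m, (Finset.univ.filter fun v => φ v = i + 1 + 1).card = 1 := by
    intro i hi
    rw [Finset.mem_range] at hi
    exact hφ.labelCard_eq_one (by omega) (by omega)
  rw [Finset.sum_congr rfl h1] at h
  simp only [Finset.sum_const, Finset.card_range, smul_eq_mul, mul_one, zero_add] at h
  simp only [labelCard]
  omega

/-- The largest eigenvalue of a blow-up of a cycle has a positive eigenvector, since a zero entry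
would propagate all the way around the cycle. -/
theorem IsBlowupLabelling.pos_of_eigenvector (hg : 3 ≤ g) (hφ : IsBlowupLabelling g φ) {x : V → ℝ}
    {μ : ℝ} (hx : ∀ v, 0 ≤ x v) (hpos : 0 < ∑ v, x v ^ 2)
    (h : ∀ v, nbrSum (cycleBlowup g φ) x v = μ * x v) (v : V) : 0 < x v := by
  refine lt_of_le_of_ne (hx v) fun hv => ?_
  have key : ∀ w, x w = 0 →
      labelSum φ x (cycPred g (φ w)) = 0 ∧ labelSum φ x (cycSucc g (φ w)) = 0 := by
    intro w hw
    have h1 := h w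
    rw [nbrSum_cycleBlowup hg hφ.lt, hw, mul_zero] at h1
    have h2 := labelSum_nonneg (φ := φ) hx (cycPred g (φ w))
    have h3 := labelSum_nonneg (φ := φ) hx (cycSucc g (φ w))
    constructor <;> linarith
  have step : ∀ j < g, labelSum φ x j = 0 →
      labelSum φ x (cycPred g j) = 0 ∧ labelSum φ x (cycSucc g j) = 0 := by
    intro j hj h0
    obtain ⟨w, rfl⟩ := hφ.exists_label hj
    exact key w ((labelSum_eq_zero_iff hx _).1 h0 w rfl)
  have hzero : labelSum φ x 0 = 0 := by
    have down : ∀ j < g, labelSum φ x j = 0 → labelSum φ x 0 = 0 := by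
      intro j
      induction j with
      | zero => exact fun _ h => h
      | succ j ih =>
        intro hj h0
        have := (step _ hj h0).1
        simp only [cycPred, Nat.add_one_ne_zero, if_false, Nat.add_sub_cancel] at this
        exact ih (by omega) this
    refine down (cycSucc g (φ v)) ?_ (key v hv.symm).2
    have := hφ.lt v
    unfold cycSucc
    split_ifs <;> omega
  have hall : ∀ j < g, labelSum φ x j = 0 := by
    intro j
    induction j with
    | zero => exact fun _ => hzero
    | succ j ih =>
      intro hj
      have := (step j (by omega) (ih (by omega))).2
      rwa [cycSucc, if_neg (by omega)] at this
  have : ∀ w, x w = 0 := fun w => (labelSum_eq_zero_iff hx _).1 (hall _ (hφ.lt w)) w rfl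
  simp [this] at hpos

/-- Blow-ups of the same cycle with the same class sizes are isomorphic. -/
theorem nonempty_iso_of_labelCard_eq (h : ∀ j, labelCard φ j = labelCard ψ j) :
    Nonempty (cycleBlowup g φ ≃g cycleBlowup g ψ) := by
  have e : ∀ j, Nonempty ({v // φ v = j} ≃ {v // ψ v = j}) := by
    intro j
    rw [← Fintype.card_eq, Fintype.card_subtype, Fintype.card_subtype]
    exact h j
  let E : V ≃ V' := (Equiv.sigmaFiberEquiv φ).symm.trans
    ((Equiv.sigmaCongrRight fun j => (e j).some).trans (Equiv.sigmaFiberEquiv ψ))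
  have hE : ∀ v, ψ (E v) = φ v := fun v => ((e (φ v)).some ⟨v, rfl⟩).2
  refine ⟨⟨E, ?_⟩⟩
  intro a b
  simp only [cycleBlowup, hE]

theorem IsBlowupLabelling.nonempty_iso (hφ : IsBlowupLabelling g φ) (hψ : IsBlowupLabelling g ψ)
    (h0 : labelCard φ 0 = labelCard ψ 0) (h1 : labelCard φ 1 = labelCard ψ 1) :
    Nonempty (cycleBlowup g φ ≃g cycleBlowup g ψ) := by
  refine nonempty_iso_of_labelCard_eq fun j => ?_
  rcases Nat.lt_or_ge j 2 with h | h
  · interval_cases j <;> assumption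
  · rcases Nat.lt_or_ge j g with h' | h'
    · rw [hφ.labelCard_eq_one h h', hψ.labelCard_eq_one h h']
    · rw [hφ.labelCard_eq_zero h', hψ.labelCard_eq_zero h']

theorem labelCard_reflect_zero (hφ : ∀ v, φ v < g) :
    labelCard (fun v => cycReflect g (φ v)) 0 = labelCard φ 1 := by
  rw [labelCard, labelCard]
  congr 1
  ext v
  have := hφ v
  simp only [Finset.mem_filter, Finset.mem_univ, true_and]
  unfold cycReflect
  split_ifs <;> omega

theorem labelCard_reflect_one (hφ : ∀ v, φ v < g) :
    labelCard (fun v => cycReflect g (φ v)) 1 = labelCard φ 0 := by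
  rw [labelCard, labelCard]
  congr 1
  ext v
  have := hφ v
  simp only [Finset.mem_filter, Finset.mem_univ, true_and]
  unfold cycReflect
  split_ifs <;> omega

end Blowup

/-! ### Balancing the two classes of a blow-up -/

/-- A sequence satisfying the eigenvalue equation along a path, reflected and subtracted from
itself, is convex; so the end with the larger total weight `p * a > q * b` cannot also carry the
larger weight `a ≥ b` per vertex. -/
theorem lt_of_path_recurrence {g : ℕ} (hg : 2 ≤ g) {μ p q a b : ℝ} {F : ℕ → ℝ} (hμ : 2 ≤ μ)
    (hb : 0 < b) (hq : 0 < q) (hpq : q < p) (hFg : F g = p * a) (hF1 : F 1 = q * b)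
    (h0 : μ * a = F (g - 1) + F 1) (h1 : μ * b = F g + F 2)
    (hF : ∀ j, 2 ≤ j → j < g → μ * F j = F (j - 1) + F (j + 1)) : a < b := by
  by_contra! hab
  have hend : F 1 < F g := by
    rw [hFg, hF1]
    nlinarith
  have hnext : F g - F 1 ≤ F (g - 1) - F 2 := by nlinarith
  have key : ∀ i, i + 2 ≤ g → F g - F 1 ≤ F (g - i) - F (i + 1) ∧
      F (g - i) - F (i + 1) ≤ F (g - (i + 1)) - F (i + 2) := by
    intro i
    induction i with
    | zero => exact fun _ => ⟨le_rfl, hnext⟩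
    | succ i ih =>
      intro hi
      obtain ⟨h2, h3⟩ := ih (by omega)
      have h4 := hF (g - (i + 1)) (by omega) (by omega)
      have h5 := hF (i + 2) (by omega) (by omega)
      rw [show g - (i + 1) - 1 = g - (i + 2) by omega,
        show g - (i + 1) + 1 = g - i by omega] at h4
      rw [show i + 2 - 1 = i + 1 by omega] at h5
      refine ⟨h2.trans h3, ?_⟩
      have h6 : 0 < F (g - (i + 1)) - F (i + 2) := by linarith
      show F (g - (i + 1)) - F (i + 2) ≤ F (g - (i + 2)) - F (i + 2 + 1)
      nlinarith
  obtain ⟨m, rfl⟩ := Nat.exists_eq_add_of_le' hg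
  have := key m le_rfl
  rw [show m + 2 - (m + 1) = 1 by omega] at this
  linarith [this.1, this.2]

section Balance

variable {V : Type*} [Fintype V] {V' : Type*} [Fintype V'] {g : ℕ} {φ : V → ℕ} {ψ : V' → ℕ}

theorem IsBlowupLabelling.two_le_lambdaOne (hg : 3 ≤ g) (hφ : IsBlowupLabelling g φ) :
    2 ≤ lambdaOne (cycleBlowup g φ) := by
  obtain ⟨v₀, -⟩ := hφ.exists_zero
  have : Nonempty V := ⟨v₀⟩
  refine le_lambdaOne_of_mul_le_nbrSum (x := fun _ => 1) (fun _ => zero_le_one) ?_ fun v => ?_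
  · simp [Fintype.card_pos]
  · rw [nbrSum_cycleBlowup hg hφ.lt, labelSum_eq_mul (c := 1) fun _ _ => rfl,
      labelSum_eq_mul (c := 1) fun _ _ => rfl]
    have hv := hφ.lt v
    have h1 : 0 < labelCard φ (cycPred g (φ v)) :=
      labelCard_pos_iff.2 (hφ.exists_label (by unfold cycPred; split_ifs <;> omega))
    have h2 : 0 < labelCard φ (cycSucc g (φ v)) :=
      labelCard_pos_iff.2 (hφ.exists_label (by unfold cycSucc; split_ifs <;> omega))
    have h1' : (1 : ℝ) ≤ labelCard φ (cycPred g (φ v)) := by exact_mod_cast h1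
    have h2' : (1 : ℝ) ≤ labelCard φ (cycSucc g (φ v)) := by exact_mod_cast h2
    linarith

/-- Making the two class sizes of a blow-up more equal strictly increases the largest eigenvalue.
In terms of the total weights `F j` of the classes, the eigenvalue equation on the path from
class `1` to class `0` does not depend on the class sizes and is invariant under reflection. So a
combination of `F` and its reflection satisfies it again, and the coefficients can be chosen such
that `A x ≥ μ x` holds, strictly somewhere, on the more balanced graph. -/
theorem IsBlowupLabelling.lambdaOne_lt (hg : 3 ≤ g) (hφ : IsBlowupLabelling g φ)
    (hψ : IsBlowupLabelling g ψ)
    (hsum : labelCard φ 0 + labelCard φ 1 = labelCard ψ 0 + labelCard ψ 1)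
    (h0 : labelCard φ 1 < labelCard ψ 0) (h1 : labelCard φ 1 < labelCard ψ 1) :
    lambdaOne (cycleBlowup g φ) < lambdaOne (cycleBlowup g ψ) := by
  obtain ⟨v₀, hv₀⟩ := hφ.exists_zero
  obtain ⟨v₁, hv₁⟩ := hφ.exists_one
  obtain ⟨w₀, hw₀⟩ := hψ.exists_zero
  have : Nonempty V := ⟨v₀⟩
  have hμ := hφ.two_le_lambdaOne hg
  obtain ⟨x, hx0, hxpos, hx⟩ := exists_nonneg_eigenvector (cycleBlowup g φ)
  have hxp := hφ.pos_of_eigenvector hg hx0 hxpos hx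
  set μ := lambdaOne (cycleBlowup g φ) with hμdef
  have hx' : ∀ v, labelSum φ x (cycPred g (φ v)) + labelSum φ x (cycSucc g (φ v)) = μ * x v :=
    fun v => by rw [← nbrSum_cycleBlowup hg hφ.lt, hx]
  have hconst : ∀ u v, φ u = φ v → x u = x v := by
    intro u v huv
    have h2 := hx' u
    rw [huv, hx' v] at h2
    exact (mul_left_cancel₀ (by linarith) h2).symm
  have hq : 0 < labelCard φ 1 := labelCard_pos_iff.2 ⟨v₁, hv₁⟩
  set a := x v₀ with ha
  set b := x v₁ with hb
  have hap : 0 < a := hxp _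
  have hbp : 0 < b := hxp _
  -- the total weight of class `0` is placed at the index `g` as well, so that the path from
  -- class `1` to class `0` is `1, 2, …, g`
  let F : ℕ → ℝ := fun j => if j = g then labelSum φ x 0 else labelSum φ x j
  have hFlt : ∀ j, j ≠ g → F j = labelSum φ x j := fun j hj => if_neg hj
  have hFg' : F g = labelSum φ x 0 := if_pos rfl
  have hFg : F g = labelCard φ 0 * a := by
    rw [hFg']
    exact labelSum_eq_mul fun v hv => hconst _ _ (hv.trans hv₀.symm)
  have hF1 : F 1 = labelCard φ 1 * b := by
    rw [hFlt _ (by omega)]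
    exact labelSum_eq_mul fun v hv => hconst _ _ (hv.trans hv₁.symm)
  have hF0 : μ * a = F (g - 1) + F 1 := by
    rw [hFlt _ (by omega), hFlt _ (by omega), ← hx' v₀, hv₀]
    simp [cycPred, cycSucc, show 1 ≠ g by omega]
  have hF2 : μ * b = F g + F 2 := by
    rw [hFg', hFlt _ (by omega), ← hx' v₁, hv₁]
    simp [cycPred, cycSucc, show 2 ≠ g by omega]
  have hF : ∀ j, 2 ≤ j → j < g → μ * F j = F (j - 1) + F (j + 1) := by
    intro j hj hjg
    obtain ⟨v, hv, hu⟩ := hφ.existsUnique j hj hjg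
    have h2 : labelSum φ x j = x v := by
      rw [labelSum_eq_mul (c := x v) fun w hw => by rw [hu w hw], hφ.labelCard_eq_one hj hjg]
      simp
    rw [hFlt j (by omega), h2, ← hx' v, hv, hFlt (j - 1) (by omega)]
    simp only [cycPred, cycSucc, F, if_neg (show j ≠ 0 by omega)]
    split_ifs <;> rfl
  have hab : a < b := lt_of_path_recurrence (by omega) hμ hbp (by exact_mod_cast hq)
    (by exact_mod_cast (show labelCard φ 1 < labelCard φ 0 by omega)) hFg hF1 hF0 hF2 hF
  have hFpos : ∀ j, 0 ≤ F j := by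
    intro j
    by_cases hj : j = g
    · rw [hj, hFg']; exact labelSum_nonneg hx0 _
    · rw [hFlt j hj]; exact labelSum_nonneg hx0 _
  set p : ℝ := (labelCard φ 0 : ℝ) with hp
  set q : ℝ := (labelCard φ 1 : ℝ) with hqdef
  have hq' : 0 < q := by simpa [hqdef] using hq
  have hsum' : p + q = labelCard ψ 0 + labelCard ψ 1 := by rw [hp, hqdef]; exact_mod_cast hsum
  -- the combination is `d a F + e b Fʳ`, where `Fʳ` is the reflection of `F`; with these
  -- coefficients the condition at class `1` is an equality and the one at class `0` is `a < b`
  obtain ⟨e, he⟩ : ∃ e, e = labelCard ψ 1 - q := ⟨_, rfl⟩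
  obtain ⟨d, hd⟩ : ∃ d, d = labelCard ψ 0 - q := ⟨_, rfl⟩
  have he0 : 0 < e := by
    have : q < labelCard ψ 1 := by rw [hqdef]; exact_mod_cast h1
    linarith
  have hd0 : 0 < d := by
    have : q < labelCard ψ 0 := by rw [hqdef]; exact_mod_cast h0
    linarith
  have hp' : p = q + d + e := by linarith
  have hψ0 : (labelCard ψ 0 : ℝ) = q + d := by linarith
  have hψ1 : (labelCard ψ 1 : ℝ) = q + e := by linarith
  let Y : ℕ → ℝ := fun j => d * a * F j + e * b * F (g + 1 - j)
  have hYpos : ∀ j, 0 ≤ Y j := fun j => by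
    have := hFpos j
    have := hFpos (g + 1 - j)
    positivity
  have hY : ∀ j, 2 ≤ j → j < g → μ * Y j = Y (j - 1) + Y (j + 1) := by
    intro j hj hjg
    have h2 := hF j hj hjg
    have h3 := hF (g + 1 - j) (by omega) (by omega)
    rw [show g + 1 - j - 1 = g + 1 - (j + 1) by omega,
      show g + 1 - j + 1 = g + 1 - (j - 1) by omega] at h3
    simp only [Y]
    linear_combination d * a * h2 + e * b * h3
  have hYg : Y g = d * a * F g + e * b * F 1 := by
    simp only [Y]; rw [show g + 1 - g = 1 by omega]
  have hY1 : Y 1 = d * a * F 1 + e * b * F g := by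
    simp only [Y]; rw [show g + 1 - 1 = g by omega]
  have hYg1 : Y (g - 1) = d * a * F (g - 1) + e * b * F 2 := by
    simp only [Y]; rw [show g + 1 - (g - 1) = 2 by omega]
  have hY2 : Y 2 = d * a * F 2 + e * b * F (g - 1) := by
    simp only [Y]; rw [show g + 1 - 2 = g - 1 by omega]
  let y : V' → ℝ := fun v =>
    if ψ v = 0 then Y g / (q + d) else if ψ v = 1 then Y 1 / (q + e) else Y (ψ v)
  have hy0 : labelSum ψ y 0 = Y g := by
    rw [labelSum_eq_mul (c := Y g / (q + d)) fun v hv => by simp [y, hv], hψ0]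
    field_simp
  have hy1 : labelSum ψ y 1 = Y 1 := by
    rw [labelSum_eq_mul (c := Y 1 / (q + e)) fun v hv => by simp [y, hv], hψ1]
    field_simp
  have hyj : ∀ j, 2 ≤ j → j < g → labelSum ψ y j = Y j := by
    intro j hj hjg
    rw [labelSum_eq_mul (c := Y j) fun v hv => by
      simp [y, hv, show j ≠ 0 by omega, show j ≠ 1 by omega], hψ.labelCard_eq_one hj hjg]
    simp
  have hyj' : ∀ j, 1 ≤ j → j < g → labelSum ψ y j = Y j := by
    intro j hj hjg
    rcases hj.eq_or_lt with rfl | hj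
    · exact hy1
    · exact hyj j hj hjg
  have hynn : ∀ v, 0 ≤ y v := by
    intro v
    have := hYpos g
    have := hYpos 1
    have := hYpos (ψ v)
    simp only [y]
    split_ifs <;> positivity
  have hYgpos : 0 < Y g := by
    rw [hYg, hFg, hF1, hp']
    positivity
  have hyw₀ : y w₀ = Y g / (q + d) := by simp [y, hw₀]
  have hstrict : μ * y w₀ < nbrSum (cycleBlowup g ψ) y w₀ := by
    rw [nbrSum_cycleBlowup hg hψ.lt, hw₀, hyw₀]
    simp only [cycPred, cycSucc, if_true, zero_add, if_neg (show 1 ≠ g by omega)]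
    rw [hyj' _ (by omega) (by omega), hy1, hYg1, hY1, hYg]
    have h2 : d * a * F (g - 1) + e * b * F 2 + (d * a * F 1 + e * b * F g) =
        μ * (d * a * a + e * b * b) := by
      linear_combination (-d * a) * hF0 + (-e * b) * hF2
    rw [h2]
    refine mul_lt_mul_of_pos_left ?_ (by linarith)
    rw [div_lt_iff₀ (by positivity), hFg, hF1, hp']
    have : 0 < d * e * (b - a) * (b + a) :=
      mul_pos (mul_pos (mul_pos hd0 he0) (by linarith)) (by linarith)
    nlinarith
  refine lt_lambdaOne_of_mul_le_nbrSum hynn ?_ (fun v => ?_) hstrict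
  · refine Finset.sum_pos' (fun _ _ => by positivity) ⟨w₀, Finset.mem_univ _, ?_⟩
    rw [hyw₀]
    positivity
  · by_cases hv0 : ψ v = 0
    · have h2 : y v = y w₀ := by simp [y, hv0, hw₀]
      have h3 : nbrSum (cycleBlowup g ψ) y v = nbrSum (cycleBlowup g ψ) y w₀ := by
        rw [nbrSum_cycleBlowup hg hψ.lt, nbrSum_cycleBlowup hg hψ.lt, hv0, hw₀]
      rw [h2, h3]
      exact hstrict.le
    rw [nbrSum_cycleBlowup hg hψ.lt]
    by_cases hv1 : ψ v = 1
    · have h2 : y v = Y 1 / (q + e) := by simp [y, hv1]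
      rw [h2, hv1]
      simp only [cycPred, cycSucc, one_ne_zero, if_false, Nat.sub_self, Nat.reduceAdd]
      have h3 : labelSum ψ y (if 2 = g then 0 else 2) = Y 2 := by
        rw [if_neg (by omega)]
        exact hyj _ le_rfl (by omega)
      rw [h3, hy0, hYg, hY2, hY1]
      have h4 : d * a * F g + e * b * F 1 + (d * a * F 2 + e * b * F (g - 1)) =
          μ * (d * a * b + e * b * a) := by
        linear_combination (-d * a) * hF2 + (-e * b) * hF0
      rw [h4]
      refine mul_le_mul_of_nonneg_left ?_ (by linarith)
      rw [div_le_iff₀ (by positivity), hFg, hF1, hp']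
      apply le_of_eq
      ring
    · have h2 : y v = Y (ψ v) := by simp [y, hv0, hv1]
      have hvg := hψ.lt v
      rw [h2, hY _ (by omega) hvg]
      simp only [cycPred, cycSucc, if_neg hv0]
      rw [hyj' _ (by omega) (by omega)]
      split_ifs with h3
      · rw [hy0, h3]
      · rw [hyj' _ (by omega) (by omega)]

/-- Among the blow-ups of a given cycle on a given number of vertices, the balanced one has the
largest eigenvalue, and is the only such graph up to isomorphism. -/
theorem IsBlowupLabelling.lambdaOne_le_of_balanced (hg : 3 ≤ g) (hφ : IsBlowupLabelling g φ)
    (hψ : IsBlowupLabelling g ψ) (hcard : Fintype.card V = Fintype.card V')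
    (h0 : labelCard ψ 0 ≤ labelCard ψ 1 + 1) (h1 : labelCard ψ 1 ≤ labelCard ψ 0 + 1) :
    lambdaOne (cycleBlowup g φ) ≤ lambdaOne (cycleBlowup g ψ) ∧
      (lambdaOne (cycleBlowup g φ) = lambdaOne (cycleBlowup g ψ) →
        Nonempty (cycleBlowup g φ ≃g cycleBlowup g ψ)) := by
  have hc1 := hφ.card_eq (by omega)
  have hc2 := hψ.card_eq (by omega)
  have : Nonempty V := ⟨hφ.exists_zero.choose⟩
  have hr := hφ.reflect hg
  have hr0 := labelCard_reflect_zero hφ.lt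
  have hr1 := labelCard_reflect_one hφ.lt
  have hre := cycleBlowup_reflect hg hφ.lt
  have hiso : Nonempty (cycleBlowup g φ ≃g cycleBlowup g ψ) →
      lambdaOne (cycleBlowup g φ) ≤ lambdaOne (cycleBlowup g ψ) ∧
      (lambdaOne (cycleBlowup g φ) = lambdaOne (cycleBlowup g ψ) →
        Nonempty (cycleBlowup g φ ≃g cycleBlowup g ψ)) :=
    fun ⟨e⟩ => ⟨(lambdaOne_eq_of_iso e).le, fun _ => ⟨e⟩⟩
  have hlt : lambdaOne (cycleBlowup g φ) < lambdaOne (cycleBlowup g ψ) →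
      lambdaOne (cycleBlowup g φ) ≤ lambdaOne (cycleBlowup g ψ) ∧
      (lambdaOne (cycleBlowup g φ) = lambdaOne (cycleBlowup g ψ) →
        Nonempty (cycleBlowup g φ ≃g cycleBlowup g ψ)) :=
    fun h => ⟨h.le, fun h' => absurd h' h.ne⟩
  by_cases hA : labelCard φ 0 = labelCard ψ 0
  · exact hiso (hφ.nonempty_iso hψ hA (by omega))
  by_cases hB : labelCard φ 0 = labelCard ψ 1
  · rw [← hre] at hiso ⊢
    exact hiso (hr.nonempty_iso hψ (by omega) (by omega))
  rcases le_total (labelCard φ 1) (labelCard φ 0) with hle | hle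
  · exact hlt (hφ.lambdaOne_lt hg hψ (by omega) (by omega) (by omega))
  · rw [← hre] at hlt ⊢
    exact hlt (hr.lambdaOne_lt hg hψ (by omega) (by omega) (by omega))

end Balance

/-! ### Shortest odd cycles -/

/-- `c` runs once around a closed walk of odd length `g` in `G`, and no closed walk of odd length
is shorter. -/
structure IsShortestOddCycle {V : Type*} (G : SimpleGraph V) (g : ℕ) (c : ZMod g → V) : Prop where
  odd : Odd g
  adj : ∀ i, G.Adj (c i) (c (i + 1))
  le_length : ∀ v (w : G.Walk v v), Odd w.length → g ≤ w.length

theorem exists_isShortestOddCycle {V : Type*} {G : SimpleGraph V} (hG : ¬ G.IsBipartite) :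
    ∃ (g : ℕ) (c : ZMod g → V), IsShortestOddCycle G g c := by
  classical
  rw [SimpleGraph.IsBipartite, SimpleGraph.two_colorable_iff_forall_loop_even] at hG
  push Not at hG
  obtain ⟨v₀, w₀, hw₀⟩ := hG
  rw [Nat.not_even_iff_odd] at hw₀
  have hex : ∃ g, ∃ v, ∃ w : G.Walk v v, Odd w.length ∧ w.length = g := ⟨_, v₀, w₀, hw₀, rfl⟩
  obtain ⟨v, w, hodd, hlen⟩ := Nat.find_spec hex
  have hmin : ∀ u (p : G.Walk u u), Odd p.length → w.length ≤ p.length := fun u p hp =>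
    hlen.trans_le (Nat.find_min' hex ⟨u, p, hp, rfl⟩)
  clear hlen
  have : NeZero w.length := ⟨by rintro h; simp [h] at hodd⟩
  refine ⟨w.length, fun i => w.getVert i.val, hodd, fun i => ?_, hmin⟩
  have hi := ZMod.val_lt i
  have h1 := w.adj_getVert_succ hi
  have h2 : w.getVert (i + 1).val = w.getVert (i.val + 1) := by
    rw [ZMod.val_add, ZMod.val_one_eq_one_mod, Nat.add_mod_mod]
    rcases Nat.lt_or_ge (i.val + 1) w.length with h | h
    · rw [Nat.mod_eq_of_lt h]
    · rw [show i.val + 1 = w.length by omega, Nat.mod_self, w.getVert_zero, w.getVert_length]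
  rwa [h2]

namespace IsShortestOddCycle

variable {V : Type*} {G : SimpleGraph V} {g : ℕ} {c : ZMod g → V}

theorem reparam (h : IsShortestOddCycle G g c) (i : ZMod g) {ε : ZMod g} (hε : ε = 1 ∨ ε = -1) :
    IsShortestOddCycle G g (fun j => c (i + ε * j)) := by
  refine ⟨h.odd, fun j => ?_, h.le_length⟩
  rcases hε with rfl | rfl
  · have := h.adj (i + 1 * j)
    rwa [show i + 1 * j + 1 = i + 1 * (j + 1) by ring] at this
  · have := h.adj (i + -1 * (j + 1))
    rw [show i + -1 * (j + 1) + 1 = i + -1 * j by ring] at this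
    exact this.symm

theorem exists_walk (h : IsShortestOddCycle G g c) (i : ZMod g) (n : ℕ) :
    ∃ w : G.Walk (c i) (c (i + n)), w.length = n := by
  induction n with
  | zero => exact ⟨SimpleGraph.Walk.nil.copy rfl (by simp), by simp⟩
  | succ n ih =>
    obtain ⟨w, hw⟩ := ih
    exact ⟨(w.concat (h.adj _)).copy rfl (by push_cast; rw [add_assoc]), by simp [hw]⟩

/-- A walk between two vertices of a shortest odd cycle can be replaced by a no longer walk of the
same parity along the cycle: otherwise it would form a shorter odd closed walk with one of the two
arcs of the cycle. -/
theorem exists_int (h : IsShortestOddCycle G g c) {i j : ZMod g} (p : G.Walk (c i) (c j)) :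
    ∃ z : ℤ, |z| ≤ p.length ∧ z % 2 = p.length % 2 ∧ j = i + z := by
  have hodd := h.odd
  have : NeZero g := ⟨by rintro rfl; simp at hodd⟩
  have hd := ZMod.val_lt (j - i)
  obtain ⟨d, hd'⟩ : ∃ d, d = (j - i).val := ⟨_, rfl⟩
  rw [← hd'] at hd
  have hj : j = i + (d : ZMod g) := by rw [hd', ZMod.natCast_zmod_val]; ring
  obtain ⟨q, hq⟩ := h.exists_walk i d
  obtain ⟨r, hr⟩ := h.exists_walk j (g - d)
  have hi : j + ((g - d : ℕ) : ZMod g) = i := by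
    rw [Nat.cast_sub hd.le, hj]; simp
  obtain ⟨m, hm⟩ := hodd
  by_cases hpar : d % 2 = p.length % 2
  · have hl := h.le_length _ (p.append (r.copy rfl (by rw [hi])))
    simp only [SimpleGraph.Walk.length_append, SimpleGraph.Walk.length_copy, hr] at hl
    have := hl (by rw [Nat.odd_iff]; omega)
    exact ⟨d, by rw [abs_of_nonneg (by omega)]; omega, by omega, by simpa using hj⟩
  · have hl := h.le_length _ (p.append (q.copy rfl (by rw [hj])).reverse)
    simp only [SimpleGraph.Walk.length_append, SimpleGraph.Walk.length_reverse,
      SimpleGraph.Walk.length_copy, hq] at hl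
    have := hl (by rw [Nat.odd_iff]; omega)
    refine ⟨d - g, by rw [abs_of_nonpos (by omega)]; omega, by omega, ?_⟩
    rw [hj]
    simp

theorem injective (h : IsShortestOddCycle G g c) : Function.Injective c := by
  intro i j hij
  obtain ⟨z, hz1, hz2, rfl⟩ := h.exists_int (i := i) (j := j) (SimpleGraph.Walk.nil.copy rfl hij)
  simp only [SimpleGraph.Walk.length_copy, SimpleGraph.Walk.length_nil, Nat.cast_zero] at hz1
  have : z = 0 := abs_nonpos_iff.1 hz1
  simp [this]

theorem eq_of_adj (h : IsShortestOddCycle G g c) {i j : ZMod g} (hij : G.Adj (c i) (c j)) :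
    j = i + 1 ∨ i = j + 1 := by
  obtain ⟨z, hz1, hz2, rfl⟩ := h.exists_int hij.toWalk
  simp only [SimpleGraph.Walk.length_cons, SimpleGraph.Walk.length_nil, SimpleGraph.Adj.toWalk]
    at hz1 hz2
  rw [abs_le] at hz1
  have : z = 1 ∨ z = -1 := by omega
  rcases this with rfl | rfl <;> simp

theorem sub_eq_of_adj_adj (h : IsShortestOddCycle G g c) {i j : ZMod g} {u : V}
    (hi : G.Adj u (c i)) (hj : G.Adj u (c j)) : j - i = 0 ∨ j - i = 2 ∨ j - i = -2 := by
  obtain ⟨z, hz1, hz2, rfl⟩ := h.exists_int (hi.symm.toWalk.append hj.toWalk)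
  simp only [SimpleGraph.Walk.length_cons, SimpleGraph.Walk.length_nil, SimpleGraph.Adj.toWalk,
    SimpleGraph.Walk.length_append] at hz1 hz2
  rw [abs_le] at hz1
  have : z = 0 ∨ z = 2 ∨ z = -2 := by omega
  rcases this with rfl | rfl | rfl <;> simp

theorem sub_eq_of_adj_adj_adj (h : IsShortestOddCycle G g c) {i j : ZMod g} {u v : V}
    (hi : G.Adj u (c i)) (huv : G.Adj u v) (hj : G.Adj v (c j)) :
    j - i = 1 ∨ j - i = -1 ∨ j - i = 3 ∨ j - i = -3 := by
  obtain ⟨z, hz1, hz2, rfl⟩ :=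
    h.exists_int ((hi.symm.toWalk.append huv.toWalk).append hj.toWalk)
  simp only [SimpleGraph.Walk.length_cons, SimpleGraph.Walk.length_nil, SimpleGraph.Adj.toWalk,
    SimpleGraph.Walk.length_append] at hz1 hz2
  rw [abs_le] at hz1
  have : z = 1 ∨ z = -1 ∨ z = 3 ∨ z = -3 := by omega
  rcases this with rfl | rfl | rfl | rfl <;> simp

theorem not_triangle (h : IsShortestOddCycle G g c) (hg : 5 ≤ g) {u v w : V} (huv : G.Adj u v)
    (hvw : G.Adj v w) (hwu : G.Adj w u) : False := by
  have := h.le_length u ((huv.toWalk.append hvw.toWalk).append hwu.toWalk)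
  simp only [SimpleGraph.Walk.length_cons, SimpleGraph.Walk.length_nil, SimpleGraph.Adj.toWalk,
    SimpleGraph.Walk.length_append] at this
  have := this (by decide)
  omega

theorem le_of_shortOddCycleFree (h : IsShortestOddCycle G g c) {k : ℕ}
    (hG : ShortOddCycleFree k G) : 2 * k + 3 ≤ g := by
  by_contra! hlt
  obtain ⟨m, rfl⟩ := h.odd
  rcases Nat.eq_zero_or_pos m with rfl | hm
  · have h0 := h.adj 0
    rw [show (0 + 1 : ZMod (2 * 0 + 1)) = 0 from rfl] at h0
    exact h0.ne rfl
  obtain ⟨m, rfl⟩ := Nat.exists_eq_add_of_le' hm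
  refine hG (m + 1) (by omega) (by omega) ⟨SimpleGraph.Hom.toCopy ⟨c, ?_⟩ h.injective⟩
  intro a b hab
  have key : ∀ a b : ZMod (2 * (m + 1) + 1), a - b = 1 → G.Adj (c b) (c a) := by
    intro a b hab
    have := h.adj b
    rwa [show b + 1 = a by rw [← hab]; ring] at this
  exact (SimpleGraph.cycleGraph_adj.1 hab).elim (fun h1 => (key a b h1).symm) (key b a)

end IsShortestOddCycle

theorem natCast_ne_zero_of_odd {g : ℕ} (hodd : Odd g) (hg : 5 ≤ g) :
    (2 : ZMod g) ≠ 0 ∧ (4 : ZMod g) ≠ 0 ∧ (6 : ZMod g) ≠ 0 ∧ (8 : ZMod g) ≠ 0 := by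
  have key : ∀ n : ℕ, 0 < n → n ≤ 8 → n % 2 = 0 → ((n : ℕ) : ZMod g) ≠ 0 := by
    intro n h0 h8 h2 hn
    rw [ZMod.natCast_eq_zero_iff] at hn
    obtain ⟨t, rfl⟩ := hn
    obtain ⟨m, rfl⟩ := hodd
    have : t = 1 ∨ t = 0 := by
      by_contra! h
      have : 2 ≤ t := by omega
      nlinarith
    rcases this with rfl | rfl <;> omega
  exact ⟨by exact_mod_cast key 2 (by norm_num) (by norm_num) rfl,
    by exact_mod_cast key 4 (by norm_num) (by norm_num) rfl,
    by exact_mod_cast key 6 (by norm_num) (by norm_num) rfl,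
    by exact_mod_cast key 8 (by norm_num) (by norm_num) rfl⟩

/-- If `P` and `Q` are the positions on a shortest odd cycle of the neighbours of two adjacent
vertices outside the cycle, then these two vertices attach to the cycle like two consecutive
vertices of the cycle do. -/
theorem exists_consecutive_centres {g : ℕ} (hodd : Odd g) (hg : 5 ≤ g) {P Q : ZMod g → Prop}
    (hP : ∀ a b, P a → P b → b - a = 0 ∨ b - a = 2 ∨ b - a = -2)
    (hQ : ∀ a b, Q a → Q b → b - a = 0 ∨ b - a = 2 ∨ b - a = -2)
    (hPQ : ∀ a b, P a → Q b → b - a = 1 ∨ b - a = -1 ∨ b - a = 3 ∨ b - a = -3) :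
    ∃ i ε : ZMod g, (ε = 1 ∨ ε = -1) ∧ (∀ a, P a → a = i - ε ∨ a = i + ε) ∧
      ∀ b, Q b → b = i ∨ b = i + 2 * ε := by
  obtain ⟨h2, h4, h6, h8⟩ := natCast_ne_zero_of_odd hodd hg
  -- in each case the centres are forced by two positions at distance `2`, if `P` or `Q` has such
  -- a pair, and otherwise `P` and `Q` have at most one element each
  by_cases hP2 : ∃ m, P m ∧ P (m + 2)
  · obtain ⟨m, hm, hm'⟩ := hP2
    have hPm : ∀ a, P a → a = m ∨ a = m + 2 := fun a ha => by
      have := hP _ _ hm ha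
      have := hP _ _ hm' ha
      grind
    have hQm : ∀ b, Q b → b = m + 1 ∨ b = m + 3 ∨ b = m - 1 := fun b hb => by
      have := hPQ _ _ hm hb
      have := hPQ _ _ hm' hb
      grind
    by_cases hQ1 : Q (m - 1)
    · refine ⟨m + 1, -1, Or.inr rfl, fun a ha => ?_, fun b hb => ?_⟩
      · have := hPm a ha
        grind
      · have := hQm b hb
        have := hQ _ _ hQ1 hb
        grind
    · refine ⟨m + 1, 1, Or.inl rfl, fun a ha => ?_, fun b hb => ?_⟩
      · have := hPm a ha
        grind
      · have := hQm b hb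
        have h9 : b ≠ m - 1 := fun h9 => hQ1 (h9 ▸ hb)
        grind
  by_cases hQ2 : ∃ l, Q l ∧ Q (l + 2)
  · obtain ⟨l, hl, hl'⟩ := hQ2
    have hQl : ∀ b, Q b → b = l ∨ b = l + 2 := fun b hb => by
      have := hQ _ _ hl hb
      have := hQ _ _ hl' hb
      grind
    have hPl : ∀ a, P a → a = l + 1 ∨ a = l + 3 ∨ a = l - 1 := fun a ha => by
      have := hPQ _ _ ha hl
      have := hPQ _ _ ha hl'
      grind
    by_cases hP1 : P (l - 1)
    · refine ⟨l, 1, Or.inl rfl, fun a ha => ?_, fun b hb => ?_⟩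
      · have := hPl a ha
        have := hP _ _ hP1 ha
        grind
      · have := hQl b hb
        grind
    · refine ⟨l + 2, -1, Or.inr rfl, fun a ha => ?_, fun b hb => ?_⟩
      · have := hPl a ha
        have h9 : a ≠ l - 1 := fun h9 => hP1 (h9 ▸ ha)
        grind
      · have := hQl b hb
        grind
  have hPu : ∀ a b, P a → P b → b = a := fun a b ha hb => by
    have h9 : b ≠ a + 2 := fun h9 => hP2 ⟨a, ha, h9 ▸ hb⟩
    have h10 : a ≠ b + 2 := fun h10 => hP2 ⟨b, hb, h10 ▸ ha⟩
    have := hP _ _ ha hb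
    grind
  have hQu : ∀ a b, Q a → Q b → b = a := fun a b ha hb => by
    have h9 : b ≠ a + 2 := fun h9 => hQ2 ⟨a, ha, h9 ▸ hb⟩
    have h10 : a ≠ b + 2 := fun h10 => hQ2 ⟨b, hb, h10 ▸ ha⟩
    have := hQ _ _ ha hb
    grind
  by_cases hP1 : ∃ m, P m
  · obtain ⟨m, hm⟩ := hP1
    by_cases hQ1 : ∃ l, Q l
    · obtain ⟨l, hl⟩ := hQ1
      have hml : ∃ ε : ZMod g, (ε = 1 ∨ ε = -1) ∧ (l = m + ε ∨ l = m + 3 * ε) := by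
        rcases hPQ _ _ hm hl with h | h | h | h
        · exact ⟨1, Or.inl rfl, Or.inl (by grind)⟩
        · exact ⟨-1, Or.inr rfl, Or.inl (by grind)⟩
        · exact ⟨1, Or.inl rfl, Or.inr (by grind)⟩
        · exact ⟨-1, Or.inr rfl, Or.inr (by grind)⟩
      obtain ⟨ε, hε, hml⟩ := hml
      refine ⟨m + ε, ε, hε, fun a ha => ?_, fun b hb => ?_⟩
      · have := hPu _ _ hm ha
        grind
      · have := hQu _ _ hl hb
        grind
    · refine ⟨m + 1, 1, Or.inl rfl, fun a ha => ?_, fun b hb => absurd ⟨b, hb⟩ hQ1⟩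
      have := hPu _ _ hm ha
      grind
  · by_cases hQ1 : ∃ l, Q l
    · obtain ⟨l, hl⟩ := hQ1
      exact ⟨l, 1, Or.inl rfl, fun a ha => absurd ⟨a, ha⟩ hP1, fun b hb => Or.inl (hQu _ _ hl hb)⟩
    · exact ⟨0, 1, Or.inl rfl, fun a ha => absurd ⟨a, ha⟩ hP1, fun b hb => absurd ⟨b, hb⟩ hQ1⟩

/-! ### Symmetrization along a shortest odd cycle -/

theorem val_add_one_eq_cycSucc {g : ℕ} [NeZero g] (a : ZMod g) :
    (a + 1).val = cycSucc g a.val := by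
  have := ZMod.val_lt a
  rw [ZMod.val_add, ZMod.val_one_eq_one_mod, Nat.add_mod_mod, cycSucc]
  split_ifs with h
  · rw [h, Nat.mod_self]
  · exact Nat.mod_eq_of_lt (by omega)

theorem cycAdj_val_iff {g : ℕ} (hg : 3 ≤ g) (a b : ZMod g) :
    CycAdj g a.val b.val ↔ b = a + 1 ∨ a = b + 1 := by
  have : NeZero g := ⟨by omega⟩
  have ha := ZMod.val_lt a
  have hb := ZMod.val_lt b
  have key : ∀ a b : ZMod g, b = a + 1 ↔ b.val = cycSucc g a.val := fun a b => by
    rw [← val_add_one_eq_cycSucc]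
    exact (ZMod.val_injective g).eq_iff.symm
  rw [key, key, CycAdj, cycSucc, cycSucc]
  split_ifs <;> omega

/-- A labelling that is inverse to `c` on the cycle and takes the values `0` and `1` outside it. -/
theorem isBlowupLabelling_of_extend {V : Type*} {g : ℕ} (hg : 3 ≤ g) {c : ZMod g → V}
    {κ : V → ZMod g} (hc : ∀ j, κ (c j) = j) (h : ∀ v ∉ Set.range c, κ v = 0 ∨ κ v = 1) :
    IsBlowupLabelling g (fun v => (κ v).val) := by
  have : NeZero g := ⟨by omega⟩
  have h1 : (1 : ZMod g).val = 1 := by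
    rw [ZMod.val_one_eq_one_mod, Nat.mod_eq_of_lt (by omega)]
  refine ⟨fun v => ZMod.val_lt _, ⟨c 0, by simp [hc]⟩, ⟨c 1, by simp [hc, h1]⟩, fun j hj hjg => ?_⟩
  refine ⟨c j, by simp [hc, ZMod.val_natCast, Nat.mod_eq_of_lt hjg], fun v hv => ?_⟩
  by_cases hvc : v ∈ Set.range c
  · obtain ⟨i, rfl⟩ := hvc
    simp only [hc] at hv
    rw [← hv, ZMod.natCast_zmod_val]
  · rcases h v hvc with h2 | h2
    · simp [h2] at hv
      omega
    · simp only [h2, h1] at hv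
      omega

section Symmetrization

open Classical in
/-- The restriction of `x` to the set `S`, extended by zero. -/
noncomputable def restrictTo {V : Type*} (S : Set V) (x : V → ℝ) (v : V) : ℝ :=
  if v ∈ S then x v else 0

theorem restrictTo_nonneg {V : Type*} {S : Set V} {x : V → ℝ} (hx : ∀ v, 0 ≤ x v) (v : V) :
    0 ≤ restrictTo S x v := by
  unfold restrictTo
  split_ifs <;> simp [hx]

theorem mem_of_restrictTo_ne_zero {V : Type*} {S : Set V} {x : V → ℝ} {v : V}
    (h : restrictTo S x v ≠ 0) : v ∈ S := by
  by_contra hv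
  simp [restrictTo, hv] at h

variable {V : Type*} [Fintype V] {G : SimpleGraph V} {g : ℕ} {c : ZMod g → V}

/-- Splitting the adjacency form along a partition of the vertices into three sets `C`, `S`, `T`. -/
theorem adjForm_eq_split (G : SimpleGraph V) (x : V → ℝ) {C S T : Set V}
    (h : x = restrictTo C x + restrictTo S x + restrictTo T x) :
    adjForm G x = adjBilin G (restrictTo C x) (restrictTo C x) + 2 * adjBilin G (restrictTo S x) x -
      adjBilin G (restrictTo S x) (restrictTo S x) +
      2 * adjBilin G (restrictTo T x) (restrictTo C x) +
      adjBilin G (restrictTo T x) (restrictTo T x) := by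
  have h1 : adjForm G x = adjBilin G x x := rfl
  have h2 : ∀ y, adjBilin G y x = adjBilin G y (restrictTo C x) + adjBilin G y (restrictTo S x) +
      adjBilin G y (restrictTo T x) := fun y => by
    conv_lhs => rw [h]
    rw [adjBilin_add_right, adjBilin_add_right]
  have h3 : ∀ y, adjBilin G x y = adjBilin G (restrictTo C x) y + adjBilin G (restrictTo S x) y +
      adjBilin G (restrictTo T x) y := fun y => by
    conv_lhs => rw [h]
    rw [adjBilin_add_left, adjBilin_add_left]
  rw [h1, h3, h2 (restrictTo C x), h2 (restrictTo S x), h2 (restrictTo T x),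
    adjBilin_comm G (restrictTo C x) (restrictTo S x),
    adjBilin_comm G (restrictTo C x) (restrictTo T x),
    adjBilin_comm G (restrictTo S x) (restrictTo T x)]
  ring

/-- A vertex `w₀` of largest neighbour weight outside a shortest odd cycle is attached to the cycle
at most like the vertex `0` of the cycle, after renumbering the cycle. In addition, no neighbour of
`w₀` outside the cycle sees more weight on the cycle than the positions `0` and `2` carry; this is
expressed by comparison with any graph `H` in which it is adjacent to both. -/
theorem IsShortestOddCycle.exists_normalized (hc : IsShortestOddCycle G g c) (hg : 5 ≤ g)
    {x : V → ℝ} (hx : ∀ v, 0 ≤ x v) (hne : ∃ v, v ∉ Set.range c) :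
    ∃ (c' : ZMod g → V) (w₀ : V), IsShortestOddCycle G g c' ∧ w₀ ∉ Set.range c' ∧
      (∀ w ∉ Set.range c', nbrSum G x w ≤ nbrSum G x w₀) ∧
      (∀ j, G.Adj w₀ (c' j) → j = -1 ∨ j = 1) ∧
      ∀ (H : SimpleGraph V) (b : V), b ∉ Set.range c' → G.Adj w₀ b → H.Adj b (c' 0) →
        H.Adj b (c' 2) → nbrSum G (restrictTo (Set.range c') x) b ≤
          nbrSum H (restrictTo (Set.range c') x) b := by
  classical
  have hxC := restrictTo_nonneg (S := Set.range c) hx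
  obtain ⟨w₀, hw₀, hmax⟩ := Finset.exists_max_image (Finset.univ.filter (· ∉ Set.range c))
    (nbrSum G x) (by obtain ⟨v, hv⟩ := hne; exact ⟨v, by simpa using hv⟩)
  simp only [Finset.mem_filter, Finset.mem_univ, true_and] at hw₀ hmax
  obtain ⟨Q, hQ, hPQ, hQH⟩ : ∃ Q : ZMod g → Prop,
      (∀ a b, Q a → Q b → b - a = 0 ∨ b - a = 2 ∨ b - a = -2) ∧
      (∀ a b, G.Adj w₀ (c a) → Q b → b - a = 1 ∨ b - a = -1 ∨ b - a = 3 ∨ b - a = -3) ∧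
      ∀ (H : SimpleGraph V) (b : V), b ∉ Set.range c → G.Adj w₀ b → (∀ j, Q j → H.Adj b (c j)) →
        nbrSum G (restrictTo (Set.range c) x) b ≤ nbrSum H (restrictTo (Set.range c) x) b := by
    by_cases hB : ∃ b, b ∉ Set.range c ∧ G.Adj w₀ b
    · obtain ⟨b, hb, hbmax⟩ := Finset.exists_max_image
        (Finset.univ.filter fun b => b ∉ Set.range c ∧ G.Adj w₀ b)
        (nbrSum G (restrictTo (Set.range c) x))
        (by obtain ⟨v, hv⟩ := hB; exact ⟨v, by simpa using hv⟩)
      simp only [Finset.mem_filter, Finset.mem_univ, true_and] at hb hbmax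
      refine ⟨fun j => G.Adj b (c j), fun i j => hc.sub_eq_of_adj_adj,
        fun i j hi hj => hc.sub_eq_of_adj_adj_adj hi hb.2 hj, fun H b' hb' hw hH => ?_⟩
      refine (hbmax b' ⟨hb', hw⟩).trans (nbrSum_mono hxC fun w hw hbw => ?_)
      obtain ⟨j, rfl⟩ := mem_of_restrictTo_ne_zero hw.ne'
      exact hH j hbw
    · exact ⟨fun _ => False, fun _ _ h => h.elim, fun _ _ _ h => h.elim,
        fun H b hb hw => absurd ⟨b, hb, hw⟩ hB⟩
  obtain ⟨i, ε, hε, hP', hQ'⟩ := exists_consecutive_centres hc.odd hg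
    (P := fun j => G.Adj w₀ (c j)) (fun i j => hc.sub_eq_of_adj_adj) hQ hPQ
  have hεε : ε * ε = 1 := by rcases hε with rfl | rfl <;> ring
  have hrange : Set.range (fun j => c (i + ε * j)) = Set.range c := by
    ext v
    constructor
    · rintro ⟨j, rfl⟩
      exact ⟨_, rfl⟩
    · rintro ⟨j, rfl⟩
      refine ⟨ε * (j - i), ?_⟩
      show c (i + ε * (ε * (j - i))) = c j
      rw [← mul_assoc, hεε]
      congr 1
      ring
  refine ⟨fun j => c (i + ε * j), w₀, hc.reparam i hε, ?_, ?_, fun j hj => ?_, ?_⟩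
  · rwa [hrange]
  · rwa [hrange]
  · have h1 : ε * (ε * j) = j := by rw [← mul_assoc, hεε, one_mul]
    rcases hP' _ hj with h | h
    · left
      rw [← h1, show ε * j = -ε by linear_combination h]
      linear_combination -hεε
    · right
      rw [← h1, show ε * j = ε by linear_combination h]
      exact hεε
  · rw [hrange]
    intro H b hb hw h0 h2
    refine hQH H b hb hw fun j hj => ?_
    rcases hQ' j hj with rfl | rfl
    · simpa using h0
    · rwa [mul_comm]

/-- Zykov symmetrization outside a shortest odd cycle: all non-neighbours of the vertex `w₀` become
twins of the vertex `0` of the cycle, and all neighbours of `w₀` twins of the vertex `1`. This does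
not decrease the adjacency form. If all neighbour weights stay the same, then nothing changes:
triangle-freeness excludes every edge of `G` that is not an edge of the blow-up. -/
theorem IsShortestOddCycle.exists_blowup (hc : IsShortestOddCycle G g c) (hg : 5 ≤ g)
    {x : V → ℝ} (hx : ∀ v, 0 ≤ x v) :
    ∃ φ : V → ℕ, IsBlowupLabelling g φ ∧ adjForm G x ≤ adjForm (cycleBlowup g φ) x ∧
      ((∀ v, 0 < x v) → (∀ v, nbrSum G x v = nbrSum (cycleBlowup g φ) x v) →
        G = cycleBlowup g φ) := by
  classical
  by_cases hne : ∃ v, v ∉ Set.range c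
  swap
  · push Not at hne
    let κ : V → ZMod g := Function.extend c id fun _ => 0
    have hκ : ∀ j, κ (c j) = j := hc.injective.extend_apply _ _
    refine ⟨_, isBlowupLabelling_of_extend (by omega) hκ fun v hv => absurd (hne v) hv, ?_⟩
    have hle : G ≤ cycleBlowup g (fun v => (κ v).val) := by
      intro u v huv
      obtain ⟨i, rfl⟩ := hne u
      obtain ⟨j, rfl⟩ := hne v
      simp only [cycleBlowup, hκ]
      rw [cycAdj_val_iff (by omega)]
      exact hc.eq_of_adj huv
    exact ⟨adjForm_mono hx hle, fun hx' h => eq_of_le_of_nbrSum_eq hx' hle h⟩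
  obtain ⟨c, w₀, hc, hw₀, hmax, hw₀c, hB⟩ := hc.exists_normalized hg hx hne
  obtain ⟨h2, h4, h6, -⟩ := natCast_ne_zero_of_odd hc.odd hg
  let κ : V → ZMod g := Function.extend c id fun v => if G.Adj w₀ v then 1 else 0
  have hκ : ∀ j, κ (c j) = j := hc.injective.extend_apply _ _
  have hκ1 : ∀ v ∉ Set.range c, G.Adj w₀ v → κ v = 1 := fun v hv hw => by
    simp only [κ]
    rw [Function.extend_apply' _ _ _ hv, if_pos hw]
  have hκ0 : ∀ v ∉ Set.range c, ¬ G.Adj w₀ v → κ v = 0 := fun v hv hw => by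
    simp only [κ]
    rw [Function.extend_apply' _ _ _ hv, if_neg hw]
  have hκw₀ : κ w₀ = 0 := hκ0 _ hw₀ (G.loopless.irrefl _)
  refine ⟨fun v => (κ v).val, isBlowupLabelling_of_extend (by omega) hκ fun v hv => ?_, ?_⟩
  · by_cases hw : G.Adj w₀ v
    · exact Or.inr (hκ1 v hv hw)
    · exact Or.inl (hκ0 v hv hw)
  set H := cycleBlowup g (fun v => (κ v).val) with hHdef
  have hH : ∀ u v, H.Adj u v ↔ κ v = κ u + 1 ∨ κ u = κ v + 1 := fun u v =>
    cycAdj_val_iff (by omega) _ _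
  have hHc : ∀ i j, G.Adj (c i) (c j) → H.Adj (c i) (c j) := fun i j hij => by
    rw [hH, hκ, hκ]
    exact hc.eq_of_adj hij
  have hw₀H : ∀ v, G.Adj w₀ v → H.Adj w₀ v := fun v hv => by
    rw [hH, hκw₀]
    by_cases hvc : v ∈ Set.range c
    · obtain ⟨j, rfl⟩ := hvc
      rw [hκ]
      rcases hw₀c j hv with rfl | rfl <;> simp
    · rw [hκ1 v hvc hv]
      simp
  have htwin : ∀ u ∉ Set.range c, ¬ G.Adj w₀ u → ∀ v, H.Adj w₀ v → H.Adj u v := by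
    intro u hu hw v hv
    rw [hH, hκw₀] at hv
    rwa [hH, hκ0 u hu hw]
  constructor
  · let S : Set V := {v | v ∉ Set.range c ∧ ¬ G.Adj w₀ v}
    let T : Set V := {v | v ∉ Set.range c ∧ G.Adj w₀ v}
    have hsplit : x = restrictTo (Set.range c) x + restrictTo S x + restrictTo T x := by
      ext v
      simp only [restrictTo, Pi.add_apply, S, T, Set.mem_ofPred_eq]
      by_cases h1 : v ∈ Set.range c <;> by_cases h2 : G.Adj w₀ v <;> simp [h1, h2]
    have hCn := restrictTo_nonneg (S := Set.range c) hx
    have hSn := restrictTo_nonneg (S := S) hx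
    have hTn := restrictTo_nonneg (S := T) hx
    -- `S` are the new twins of `w₀`, `T` its neighbours; edges inside `S` are counted twice in the
    -- neighbour weights of `S`, which is harmless since the correction vanishes for `H`
    rw [adjForm_eq_split G x hsplit, adjForm_eq_split H x hsplit]
    have h1 : adjBilin G (restrictTo (Set.range c) x) (restrictTo (Set.range c) x) ≤
        adjBilin H (restrictTo (Set.range c) x) (restrictTo (Set.range c) x) := by
      refine adjBilin_le hCn fun v hv => nbrSum_mono hCn fun w hw hvw => ?_
      obtain ⟨i, rfl⟩ := mem_of_restrictTo_ne_zero hv.ne'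
      obtain ⟨j, rfl⟩ := mem_of_restrictTo_ne_zero hw.ne'
      exact hHc i j hvw
    have h2 : adjBilin G (restrictTo S x) x ≤ adjBilin H (restrictTo S x) x := by
      refine adjBilin_le hSn fun v hv => ?_
      obtain ⟨hvc, hvw⟩ := mem_of_restrictTo_ne_zero hv.ne'
      exact (hmax v hvc).trans
        (nbrSum_mono hx fun w _ hw => htwin v hvc hvw w (hw₀H w hw))
    have h3 : 0 ≤ adjBilin G (restrictTo S x) (restrictTo S x) := adjBilin_nonneg hSn hSn
    have h4 : adjBilin H (restrictTo S x) (restrictTo S x) = 0 := by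
      refine adjBilin_eq_zero fun v w hv hw hvw => ?_
      obtain ⟨hvc, hv⟩ := mem_of_restrictTo_ne_zero hv
      obtain ⟨hwc, hw⟩ := mem_of_restrictTo_ne_zero hw
      rw [hH, hκ0 v hvc hv, hκ0 w hwc hw] at hvw
      grind
    have h5 : adjBilin G (restrictTo T x) (restrictTo (Set.range c) x) ≤
        adjBilin H (restrictTo T x) (restrictTo (Set.range c) x) := by
      refine adjBilin_le hTn fun v hv => ?_
      obtain ⟨hvc, hvw⟩ := mem_of_restrictTo_ne_zero hv.ne'
      refine hB H v hvc hvw ?_ ?_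
      · rw [hH, hκ, hκ1 v hvc hvw]
        simp
      · rw [hH, hκ, hκ1 v hvc hvw]
        grind
    have h6 : adjBilin G (restrictTo T x) (restrictTo T x) = 0 := by
      refine adjBilin_eq_zero fun v w hv hw hvw => ?_
      obtain ⟨hvc, hv⟩ := mem_of_restrictTo_ne_zero hv
      obtain ⟨hwc, hw⟩ := mem_of_restrictTo_ne_zero hw
      exact hc.not_triangle hg hv hvw hw.symm
    have h7 : 0 ≤ adjBilin H (restrictTo T x) (restrictTo T x) := adjBilin_nonneg hTn hTn
    linarith
  · intro hx' heq
    have hw₀iff := adj_iff_of_nbrSum_eq hx' hw₀H (heq w₀)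
    have hw₀1 : G.Adj w₀ (c 1) := by
      rw [hw₀iff, hH, hκ, hκw₀]
      simp
    have hw₀m1 : G.Adj w₀ (c (-1)) := by
      rw [hw₀iff, hH, hκ, hκw₀]
      simp
    -- equal weights at the vertex `1` of the cycle make it adjacent to all twins of `w₀`
    have hS1 : ∀ u ∉ Set.range c, ¬ G.Adj w₀ u → G.Adj (c 1) u := by
      intro u hu hw
      rw [adj_iff_of_nbrSum_eq hx' (fun v hv => ?_) (heq (c 1)), hH, hκ, hκ0 u hu hw]
      · simp
      · by_cases hvc : v ∈ Set.range c
        · obtain ⟨j, rfl⟩ := hvc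
          exact hHc _ _ hv
        · have hvw : ¬ G.Adj w₀ v := fun hvw => hc.not_triangle hg hw₀1 hv hvw.symm
          rw [hH, hκ, hκ0 v hvc hvw]
          simp
    -- in `H` no vertex outside the cycle is attached at these positions
    have hfar : ∀ j, j ≠ -1 → j ≠ 0 → j ≠ 1 → j ≠ 2 → ∀ v, G.Adj (c j) v → H.Adj (c j) v := by
      intro j hm1 h0 h1 h2 v
      refine (adj_iff_of_nbrSum_eq hx' (G := H) (H := G) (fun w hw => ?_) (heq (c j)).symm v).2
      by_cases hwc : w ∈ Set.range c
      · obtain ⟨i, rfl⟩ := hwc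
        rw [hH, hκ, hκ] at hw
        rcases hw with rfl | rfl
        · exact hc.adj j
        · exact (hc.adj i).symm
      · exfalso
        rw [hH, hκ] at hw
        by_cases hww : G.Adj w₀ w
        · rw [hκ1 w hwc hww] at hw
          grind
        · rw [hκ0 w hwc hww] at hw
          grind
    have hout : ∀ u ∉ Set.range c, ∀ v, G.Adj u v → H.Adj u v := by
      intro u hu v huv
      by_cases huw : G.Adj w₀ u
      · by_cases hvc : v ∈ Set.range c
        · obtain ⟨j, rfl⟩ := hvc
          by_cases hj : j ≠ -1 ∧ j ≠ 0 ∧ j ≠ 1 ∧ j ≠ 2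
          · exact (hfar j hj.1 hj.2.1 hj.2.2.1 hj.2.2.2 u huv.symm).symm
          · have hj1 : j ≠ 1 := by
              rintro rfl
              exact hc.not_triangle hg huw huv hw₀1.symm
            have hjm1 : j ≠ -1 := by
              rintro rfl
              exact hc.not_triangle hg huw huv hw₀m1.symm
            rw [hH, hκ, hκ1 u hu huw]
            grind
        · have hvw : ¬ G.Adj w₀ v := fun hvw => hc.not_triangle hg huw huv hvw.symm
          rw [hH, hκ1 u hu huw, hκ0 v hvc hvw]
          simp
      · have h1u := hS1 u hu huw
        by_cases hvc : v ∈ Set.range c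
        · obtain ⟨j, rfl⟩ := hvc
          by_cases hj : j ≠ -1 ∧ j ≠ 0 ∧ j ≠ 1 ∧ j ≠ 2
          · exact (hfar j hj.1 hj.2.1 hj.2.2.1 hj.2.2.2 u huv.symm).symm
          · have hj0 : j ≠ 0 := by
              rintro rfl
              have := hc.adj 0
              rw [zero_add] at this
              exact hc.not_triangle hg h1u huv this
            have hj2 : j ≠ 2 := by
              rintro rfl
              have := hc.adj 1
              rw [one_add_one_eq_two] at this
              exact hc.not_triangle hg h1u huv this.symm
            rw [hH, hκ, hκ0 u hu huw]
            grind
        · have hvw : G.Adj w₀ v := by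
            by_contra hvw
            exact hc.not_triangle hg h1u huv (hS1 v hvc hvw).symm
          rw [hH, hκ0 u hu huw, hκ1 v hvc hvw]
          simp
    refine eq_of_le_of_nbrSum_eq hx' (fun u v huv => ?_) heq
    by_cases hu : u ∈ Set.range c
    · by_cases hv : v ∈ Set.range c
      · obtain ⟨i, rfl⟩ := hu
        obtain ⟨j, rfl⟩ := hv
        exact hHc i j huv
      · exact (hout v hv u huv.symm).symm
    · exact hout u hu v huv

end Symmetrization

/-! ### The extremal graph -/

section OddGirth

variable {V : Type*} {g : ℕ} {φ : V → ℕ}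

/-- A walk in a blow-up of a cycle winds along the cycle by steps of `±1`. -/
theorem exists_int_of_walk_cycleBlowup {u v : V} (p : (cycleBlowup g φ).Walk u v) :
    ∃ z : ℤ, |z| ≤ p.length ∧ z % 2 = p.length % 2 ∧ (g : ℤ) ∣ φ v - φ u - z := by
  induction p with
  | nil => exact ⟨0, by simp, by simp, by simp⟩
  | @cons u w v h p ih =>
    obtain ⟨z, hz1, hz2, t, ht⟩ := ih
    rw [SimpleGraph.Walk.length_cons]
    push_cast
    rw [abs_le] at hz1
    have h' : CycAdj g (φ u) (φ w) := h
    have key : ∃ e s : ℤ, (e = 1 ∨ e = -1) ∧ (φ w : ℤ) - φ u - e = g * s := by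
      rcases h' with h' | h' | ⟨h', -, h''⟩ | ⟨h', -, h''⟩
      · exact ⟨1, 0, Or.inl rfl, by rw [mul_zero]; omega⟩
      · exact ⟨-1, 0, Or.inr rfl, by rw [mul_zero]; omega⟩
      · exact ⟨-1, 1, Or.inr rfl, by rw [mul_one]; omega⟩
      · exact ⟨1, -1, Or.inl rfl, by rw [mul_neg_one]; omega⟩
    obtain ⟨e, s, he, hs⟩ := key
    refine ⟨z + e, ?_, ?_, t + s, by linear_combination ht + hs⟩
    · rw [abs_le]; omega
    · omega

theorem shortOddCycleFree_cycleBlowup {k : ℕ} (φ : V → ℕ) :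
    ShortOddCycleFree k (cycleBlowup (2 * k + 3) φ) := by
  intro i hi hik hcon
  rw [SimpleGraph.cycleGraph_isContained_iff (by omega)] at hcon
  obtain ⟨v, p, -, hp⟩ := hcon
  obtain ⟨z, hz1, hz2, hz3⟩ := exists_int_of_walk_cycleBlowup p
  rw [sub_self, zero_sub, dvd_neg] at hz3
  have := Int.eq_zero_of_abs_lt_dvd hz3 (by push_cast; omega)
  omega

theorem IsBlowupLabelling.not_isBipartite (hg : 3 ≤ g) (hodd : Odd g)
    (hφ : IsBlowupLabelling g φ) : ¬ (cycleBlowup g φ).IsBipartite := by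
  intro hbip
  obtain ⟨n, rfl⟩ := Nat.exists_eq_add_of_le' (show 2 ≤ g by omega)
  choose r hr using fun j : Fin (n + 2) => hφ.exists_label j.isLt
  have hhom : SimpleGraph.cycleGraph (n + 2) →g cycleBlowup (n + 2) φ := by
    refine ⟨r, fun {a b} hab => ?_⟩
    rw [SimpleGraph.cycleGraph_adj] at hab
    simp only [cycleBlowup, hr]
    refine (cycAdj_val_iff (g := n + 2) hg a b).2 ?_
    rcases hab with h | h
    · exact Or.inr (sub_eq_iff_eq_add'.1 h |>.trans (by rfl))
    · exact Or.inl (sub_eq_iff_eq_add'.1 h |>.trans (by rfl))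
  have h2 : (SimpleGraph.cycleGraph (n + 2)).Colorable 2 := SimpleGraph.Colorable.of_hom hhom hbip
  have h3 := h2.chromaticNumber_le
  rw [SimpleGraph.chromaticNumber_cycleGraph_of_odd _ (by omega) hodd] at h3
  exact absurd h3 (by decide)

end OddGirth

/-- The labelling that exhibits `R k s t` as a blow-up of `C_{2k+3}`: the ends of the replaced edge
get the labels `2` and `2k+2`, the new path between them the labels `3, …, 2k+1`, and the remaining
vertices of the two classes the labels `0` and `1`. -/
def labelR (k s t : ℕ) : (Fin s ⊕ Fin t) ⊕ Fin (2 * k - 1) → ℕ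
  | .inl (.inl i) => if (i : ℕ) = 0 then 2 else 0
  | .inl (.inr j) => if (j : ℕ) = 0 then 2 * k + 2 else 1
  | .inr l => l + 3

theorem R_eq_cycleBlowup {k s t : ℕ} (hk : 1 ≤ k) (hs : 0 < s) (ht : 0 < t) :
    R k s t hs ht = cycleBlowup (2 * k + 3) (labelR k s t) := by
  ext u v
  rcases u with (i | j) | l <;> rcases v with (i' | j') | l' <;>
    simp [R, replaceEdge, cycleBlowup, CycAdj, labelR, Fin.ext_iff] <;>
    (try split_ifs) <;> first | omega | (simp_all; done) | (simp_all; omega)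

theorem isBlowupLabelling_labelR {k s t : ℕ} (hk : 1 ≤ k) (hs : 2 ≤ s) (ht : 2 ≤ t) :
    IsBlowupLabelling (2 * k + 3) (labelR k s t) := by
  refine ⟨?_, ⟨.inl (.inl ⟨1, hs⟩), by simp [labelR]⟩, ⟨.inl (.inr ⟨1, ht⟩), by simp [labelR]⟩, ?_⟩
  · rintro ((i | j) | l) <;> simp only [labelR] <;> (try split_ifs) <;> omega
  · intro j hj hjg
    rcases hj.eq_or_lt with rfl | hj2
    · refine ⟨.inl (.inl ⟨0, by omega⟩), by simp [labelR], ?_⟩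
      rintro ((i | i) | l) <;> simp only [labelR] <;> intro h
      · split_ifs at h with h'
        · simp [Fin.ext_iff, h']
      · split_ifs at h <;> omega
      · omega
    rcases Nat.lt_or_ge j (2 * k + 2) with hj3 | hj3
    · refine ⟨.inr ⟨j - 3, by omega⟩, Nat.sub_add_cancel (by omega), ?_⟩
      rintro ((i | i) | l) <;> simp only [labelR] <;> intro h
      · split_ifs at h <;> omega
      · split_ifs at h <;> omega
      · simp [Fin.ext_iff]
        omega
    · refine ⟨.inl (.inr ⟨0, by omega⟩), by simp [labelR]; omega, ?_⟩
      rintro ((i | i) | l) <;> simp only [labelR] <;> intro h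
      · split_ifs at h <;> omega
      · split_ifs at h with h'
        · simp [Fin.ext_iff, h']
        · omega
      · omega

theorem labelCard_labelR_zero (k : ℕ) {s t : ℕ} (hs : 0 < s) :
    labelCard (labelR k s t) 0 = s - 1 := by
  obtain ⟨s, rfl⟩ := Nat.exists_eq_add_of_le' hs
  rw [labelCard, Finset.card_filter]
  simp only [Fintype.sum_sum_type, labelR, Fin.sum_univ_succ]
  simp
  intro j
  split_ifs <;> omega

theorem labelCard_labelR_one (k : ℕ) {s t : ℕ} (ht : 0 < t) :
    labelCard (labelR k s t) 1 = t - 1 := by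
  obtain ⟨t, rfl⟩ := Nat.exists_eq_add_of_le' ht
  rw [labelCard, Finset.card_filter]
  simp only [Fintype.sum_sum_type, labelR, Fin.sum_univ_succ]
  simp
  intro j
  split_ifs <;> omega

end ShortOddCycles

open ShortOddCycles in
theorem mainTheorem3 (k n : ℕ) (hk : 1 ≤ k) (hn : 2 * k + 4 ≤ n) :
    (Fintype.card ((Fin ((n - 2 * k + 1) / 2) ⊕ Fin ((n - 2 * k + 2) / 2)) ⊕ Fin (2 * k - 1)) = n ∧
      ShortOddCycles.ShortOddCycleFree k (ShortOddCycles.extremalGraph k n hn) ∧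
      ¬ (ShortOddCycles.extremalGraph k n hn).IsBipartite) ∧
    ∀ (V : Type*) [Fintype V] (G : SimpleGraph V),
      Fintype.card V = n →
      ShortOddCycles.ShortOddCycleFree k G →
      ¬ G.IsBipartite →
      ShortOddCycles.lambdaOne G ≤
          ShortOddCycles.lambdaOne (ShortOddCycles.extremalGraph k n hn) ∧
        (ShortOddCycles.lambdaOne G =
            ShortOddCycles.lambdaOne (ShortOddCycles.extremalGraph k n hn) ↔
          Nonempty (G ≃g ShortOddCycles.extremalGraph k n hn)) := by
  have hcard : Fintype.card
      ((Fin ((n - 2 * k + 1) / 2) ⊕ Fin ((n - 2 * k + 2) / 2)) ⊕ Fin (2 * k - 1)) = n := by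
    simp only [Fintype.card_sum, Fintype.card_fin]
    omega
  have hR : extremalGraph k n hn = cycleBlowup (2 * k + 3)
      (labelR k ((n - 2 * k + 1) / 2) ((n - 2 * k + 2) / 2)) :=
    R_eq_cycleBlowup hk (by omega) (by omega)
  have hψ : IsBlowupLabelling (2 * k + 3)
      (labelR k ((n - 2 * k + 1) / 2) ((n - 2 * k + 2) / 2)) :=
    isBlowupLabelling_labelR hk (by omega) (by omega)
  rw [hR]
  refine ⟨⟨hcard, shortOddCycleFree_cycleBlowup _,
    hψ.not_isBipartite (by omega) ⟨k + 1, by ring⟩⟩, ?_⟩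
  intro V _ G hV hfree hbip
  have : Nonempty V := Fintype.card_pos_iff.1 (by omega)
  obtain ⟨x, hx, hpos, hxG⟩ := exists_nonneg_eigenvector G
  obtain ⟨g, c, hc⟩ := exists_isShortestOddCycle hbip
  have hg := hc.le_of_shortOddCycleFree hfree
  obtain ⟨φ₀, hφ₀, hle₀, heq₀⟩ := hc.exists_blowup (by omega) hx
  obtain ⟨e, rfl⟩ : ∃ e, g = 2 * k + 3 + 2 * e := by
    obtain ⟨m, hm⟩ := hc.odd
    exact ⟨m - (k + 1), by omega⟩
  have hφ := hφ₀.fold (by omega)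
  have hfold := cycleBlowup_le_fold (h := 2 * k + 3) (e := e) (by omega) φ₀
  set H := cycleBlowup (2 * k + 3) (fun v => cycFold (2 * e) (φ₀ v)) with hH
  obtain ⟨hbal, hbal'⟩ := hφ.lambdaOne_le_of_balanced (by omega) hψ (hV.trans hcard.symm)
    (by rw [labelCard_labelR_zero _ (by omega), labelCard_labelR_one _ (by omega)]; omega)
    (by rw [labelCard_labelR_zero _ (by omega), labelCard_labelR_one _ (by omega)]; omega)
  have hform := adjForm_eq_of_nbrSum_eq hxG
  have hle₁ := adjForm_mono hx hfold
  have hle₂ := adjForm_le H x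
  have hGH : lambdaOne G ≤ lambdaOne H :=
    le_of_mul_le_mul_right (by linarith) hpos
  refine ⟨hGH.trans hbal, fun heq => ?_, fun ⟨e⟩ => lambdaOne_eq_of_iso e⟩
  have hGH' : lambdaOne G = lambdaOne H := le_antisymm hGH (hbal.trans heq.ge)
  -- `x` attains the largest eigenvalue of `H` as well, so all the estimates are equalities
  have hxH := nbrSum_eq_of_adjForm_eq H x (le_antisymm hle₂ (by rw [← hGH']; linarith))
  have hxpos := hφ.pos_of_eigenvector (by omega) hx hpos hxH
  have hformH := adjForm_eq_of_nbrSum_eq hxH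
  rw [← hGH'] at hformH
  have h₀H : cycleBlowup (2 * k + 3 + 2 * e) φ₀ = H :=
    eq_of_le_of_adjForm_eq hxpos hfold (by linarith)
  have hG : G = H := by
    rw [← h₀H]
    refine heq₀ hxpos fun v => ?_
    rw [h₀H, hxG, hxH, hGH']
  rw [hG]
  exact hbal' (hGH'.symm.trans heq)
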